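/- **Setting.** Variables are $x,y,z$, values are integers, every thread $t$ has its own registers, and thread $0$ is the initialising thread. An *action* is a read or a write of a value at a variable, or an internal action (a register assignment), together with the line it comes from. A *tagged action graph* $\sigma=(D,\mathsf{sb},\mathsf{rf},\mathsf{mo})$ consists of a set $D$ of reads and writes with unique tags and thread identifiers, and relations sequenced-before, reads-from (from writes to reads with the same variable and value, each read having at most one source) and modification order (between writes to the same variable, a strict total order on the writes to each variable). Put $\mathsf{hb}=(\mathsf{sb}\cup(\mathsf{rf}\cap \mathsf{Wr}_R\times\mathsf{Rd}_A))^+$ ($\mathsf{Wr}_R$, $\mathsf{Rd}_A$: releasing writes, acquiring reads), $\mathsf{fr}=(\mathsf{rf}^{-1};\mathsf{mo})\setminus \mathrm{Id}$, $\mathsf{eco}=(\mathsf{rf}\cup\mathsf{mo}\cup\mathsf{fr})^+$. The writes *encountered* by $t$ are the writes $w\in D$ with $(w,b)\in\mathsf{eco}^?;\mathsf{hb}^?$ for some $b\in D$ of thread $t$; the set $OW_\sigma(t)$ of writes *observable* by $t$ consists of the writes in $D$ that are not $\mathsf{mo}$-before a write encountered by $t$. A read of $x$ by $t$ takes the value of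 some $w\in OW_\sigma(t)$ on $x$ (adding an $\mathsf{rf}$ edge); a write to $x$ by $t$ is inserted in $\mathsf{mo}$ directly after some $w\in OW_\sigma(t)$ on $x$; in both cases the new action is placed $\mathsf{sb}$-after all actions of $t$ and of thread $0$. A *configuration* is a pair $(\sigma,\gamma)$ of a graph and the register contents. $[x=v]_t$ says that exactly one write to $x$ is observable by $t$ and that it has value $v$; $[x\not\approx v]_t$ says that no write to $x$ with value $v$ is observable by $t$. **Futures.** For every complete program-order run of a thread (loads return arbitrary values, guards are evaluated with them) the events of the run, ordered by the semantic dependency order stated below for the program's lines, form a *future*; an initial future of the program is a union of one future per thread. A step executes a not yet executed atomic command whose action $a$ labels a minimal event of some current future, changing registers and memory accordingly; the futures in which $a$ is not available are discarded and the events labelled $a$ are removed from the others. An execution has terminated when the current set of futures contains the empty future. The triple $\{X\}\,\mathit{Init};P\,\{Y\}$ holds if $\mathit{Init}\Rightarrow X$ and every terminated execution of $P$ from a configuration satisfying $X$ ends in a configuration satisfying $Y$. **Outlines.** A proof outline with precondition $X$ and postcondition $Y$ gives, for each thread $t$, assertions $I_t(H)$ indexed by what remains, $H$, of the futures $F_{|t}$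 of the thread ($I_t(H)$ is false for sets $H$ of futures that are not annotated, and $I_t$ is true for idle threads $t$). A *sub-future* of $F_{|t}$ is a set of up-closed subsets of members of $F_{|t}$; a set of atomic commands of the program *corresponds* to it if it has the same line labels. The outline is *valid* if $\mathit{Init}\Rightarrow X$; $X\Rightarrow I_t(F_{|t})$ for all $t$; if each $I_t$ holds at some $H$ containing the empty future, then $Y$ holds; *(local correctness)* for every $t$, every sub-future $G$ of $F_{|t}$ and every corresponding set $Q$ of atomic commands, each step of $Q$ from $G$ to some $G'$ in a configuration satisfying $I_t(G)$ leads to one satisfying $I_t(G')$; *(global correctness)* for $t_1\ne t_2$, sub-futures $F_1$ of $F_{|t_1}$ and $F_2$ of $F_{|t_2}$ and $Q$ corresponding to $F_2$, each step of $Q$ from $F_2$ in a configuration satisfying $I_{t_1}(F_1)\wedge I_{t_2}(F_2)$ leads to one satisfying $I_{t_1}(F_1)$. **Theorem.** The following two proof outlines are valid, and the triples $\{X\}\,\mathit{Init};P\,\{Y\}$ hold, where $X$ is the conjunction of the first assertions of the two threads. Assertions stand between the numbered lines; an assertion after line $k$ is indexed by what remains of the futures after executing the lines up to $k$, and the assertion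 inside a branch by what remains when the branch has been entered. All accesses are relaxed. *Simple test.* $\mathit{Init}$: $x=z=r1=r2=0$; dependency order $1\prec2$ and $3\prec4$. Thread 1: $\{[z=0]_2\wedge r2=0\wedge\forall i\ne0.\,[x\not\approx i]_1\}$ 1: $r1:=[x]$ $\{[z=0]_2\wedge r1=0\wedge r2=0\}$ 2: $[z]:=r1+1$ $\{r1\neq1\vee r2\neq2\}$. Thread 2: $\{\forall i\notin\{0,1\}.\,[z\not\approx i]_2\}$ 3: $r2:=[z]$ $\{r2\in\{0,1\}\}$ if $r2=2$ then $\{\mathit{false}\}$ 4: $[x]:=1$ $\{\mathit{true}\}$. Postcondition $Y$: $r1\neq1\vee r2\neq2$. *Full test.* $\mathit{Init}$: $x=y=z=r1=r2=r3=r4=0$; dependency order $1\prec2\prec3\prec4\prec5$ and $6\prec7$. Thread 1: $\{[y=0]_1\wedge[z=0]_2\wedge\forall i\neq0.\,[x\not\approx i]_1\}$ 1: $r1:=[x]$ $\{[y=0]_1\wedge[z=0]_2\wedge r1=0\}$ 2: $r2:=r1$ $\{[y=0]_1\wedge[z=0]_2\wedge r2=0\}$ 3: $[y]:=r2$ $\{[y=0]_1\wedge[z=0]_2\}$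 4: $r3:=[y]$ $\{[z=0]_2\wedge r3=0\}$ 5: $[z]:=r3+1$ $\{r3=0\}$. Thread 2: $\{\forall i\notin\{0,1\}.\,[z\not\approx i]_2\}$ 6: $r4:=[z]$ $\{r4\in\{0,1\}\}$ if $r4=2$ then $\{\mathit{false}\}$ 7: $[x]:=1$ $\{r4\in\{0,1\}\}$. Postcondition $Y$: $r3\neq1\vee r4\neq2$. In particular the outcomes $r1=1\wedge r2=2$ of the simple test and $r3=1\wedge r4=2$ of the full test are impossible. -/

import Mathlib

set_option linter.constructorNameAsVariable false

namespace MRD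

/-! ### Programs -/

/-- Control labels (line numbers). -/
abbrev Label := ℕ
/-- Thread identifiers; `0` is the initialising thread. -/
abbrev Tid := ℕ
abbrev Val := ℤ

/-- Shared variables. -/
inductive Loc where
  | x | y | z
  deriving DecidableEq

inductive Reg where
  | r1 | r2 | r3 | r4
  deriving DecidableEq

abbrev RegFile := Reg → Val

/-- Expressions are identified with their evaluation functions. -/
abbrev Expr := RegFile → Val
abbrev BExpr := RegFile → Bool

/-- Labelled atomic commands. The flag of a store says whether it is releasing, the flag of a load
whether it is acquiring. -/
inductive ACom where
  | skip (i : Label)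
  | store (i : Label) (rel : Bool) (x : Loc) (e : Expr)
  | load (i : Label) (acq : Bool) (r : Reg) (x : Loc)
  | assign (i : Label) (r : Reg) (e : Expr)

def ACom.label : ACom → Label
  | .skip i => i
  | .store i _ _ _ => i
  | .load i _ _ _ => i
  | .assign i _ _ => i

/-- Loop-free commands of a single thread; `done` is the unlabelled, terminated command. -/
inductive Com where
  | done
  | atom (s : ACom)
  | seq (c d : Com)
  | ite (b : BExpr) (c d : Com)

/-- A parallel program; idle threads are `Com.done`. -/
abbrev Prog := Tid → Com

/-- The atomic set of a command. -/
def Com.atoms : Com → Set ACom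
  | .done => ∅
  | .atom s => {s}
  | .seq c d => c.atoms ∪ d.atoms
  | .ite _ c d => c.atoms ∪ d.atoms

abbrev AtomicSet := Tid → Set ACom

def Prog.atoms (P : Prog) : AtomicSet := fun t => (P t).atoms

def AtomicSet.labels (Q : AtomicSet) : Set Label := {i | ∃ t, ∃ s ∈ Q t, s.label = i}

/-- `Q` is a sub-program of `P`. -/
def AtomicSet.IsSub (Q P : AtomicSet) : Prop := ∀ t, Q t ⊆ P t

/-! ### Actions and tagged action graphs -/

/-- Actions, decorated with the line they come from. `loc i` is the internal action of a
register assignment or `skip` at line `i`; it does not touch the memory. -/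
inductive Action where
  | rd (i : Label) (acq : Bool) (x : Loc) (v : Val)
  | wr (i : Label) (rel : Bool) (x : Loc) (v : Val)
  | loc (i : Label)

def Action.line : Action → Label
  | .rd i _ _ _ => i
  | .wr i _ _ _ => i
  | .loc i => i

/-- `ini x` is the tag of the initialising write of `x`. -/
inductive Tag where
  | ini (x : Loc)
  | num (n : ℕ)

/-- Tagged actions. -/
structure TA where
  tag : Tag
  act : Action
  tid : Tid

def TA.writes (b : TA) (x : Loc) (v : Val) : Prop := ∃ i rel, b.act = .wr i rel x v
def TA.reads (b : TA) (x : Loc) (v : Val) : Prop := ∃ i acq, b.act = .rd i acq x v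
def TA.IsWrite (b : TA) : Prop := ∃ x v, b.writes x v
def TA.IsRead (b : TA) : Prop := ∃ x v, b.reads x v
def TA.IsRelWrite (b : TA) : Prop := ∃ i x v, b.act = .wr i true x v
def TA.IsAcqRead (b : TA) : Prop := ∃ i x v, b.act = .rd i true x v

structure Graph where
  D : Set TA
  sb : TA → TA → Prop
  rf : TA → TA → Prop
  mo : TA → TA → Prop

/-- Well-formedness of tagged action graphs: the relations live on `D` and have the right type, and
modification order restricted to each variable is a strict total order. -/
structure Graph.WF (σ : Graph) : Prop where
  memAct : ∀ b ∈ σ.D, b.IsRead ∨ b.IsWrite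
  tagInj : ∀ b ∈ σ.D, ∀ c ∈ σ.D, b.tag = c.tag → b = c
  sbDom : ∀ b c, σ.sb b c → b ∈ σ.D ∧ c ∈ σ.D ∧ (b.tid = c.tid ∨ b.tid = 0)
  rfDom : ∀ w r, σ.rf w r → w ∈ σ.D ∧ r ∈ σ.D ∧ ∃ x v, w.writes x v ∧ r.reads x v
  rfFun : ∀ w w' r, σ.rf w r → σ.rf w' r → w = w'
  moDom : ∀ w w', σ.mo w w' →
    w ∈ σ.D ∧ w' ∈ σ.D ∧ ∃ x v v', w.writes x v ∧ w'.writes x v'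
  moIrrefl : ∀ w, ¬ σ.mo w w
  moTrans : ∀ w w' w'', σ.mo w w' → σ.mo w' w'' → σ.mo w w''
  moTotal : ∀ w ∈ σ.D, ∀ w' ∈ σ.D, ∀ x v v', w.writes x v → w'.writes x v' →
    w ≠ w' → σ.mo w w' ∨ σ.mo w' w

/-- Happens before. -/
def Graph.hb (σ : Graph) : TA → TA → Prop :=
  Relation.TransGen fun b c => σ.sb b c ∨ (σ.rf b c ∧ b.IsRelWrite ∧ c.IsAcqRead)

/-- From read. -/
def Graph.fr (σ : Graph) (r w' : TA) : Prop := (∃ w, σ.rf w r ∧ σ.mo w w') ∧ r ≠ w'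

/-- Extended coherence order. -/
def Graph.eco (σ : Graph) : TA → TA → Prop :=
  Relation.TransGen fun b c => σ.rf b c ∨ σ.mo b c ∨ σ.fr b c

/-- Encountered writes. -/
def Graph.EW (σ : Graph) (t : Tid) : Set TA :=
  {w | w ∈ σ.D ∧ w.IsWrite ∧ ∃ b ∈ σ.D, b.tid = t ∧
    Relation.Comp (Relation.ReflGen σ.eco) (Relation.ReflGen σ.hb) w b}

/-- Observable writes. -/
def Graph.OW (σ : Graph) (t : Tid) : Set TA :=
  {w | w ∈ σ.D ∧ w.IsWrite ∧ ∀ w' ∈ σ.EW t, ¬ σ.mo w w'}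

/-- Adding `b` at the end of sequenced-before. -/
def Graph.sbAdd (σ : Graph) (b : TA) : TA → TA → Prop :=
  fun c d => σ.sb c d ∨ (c ∈ σ.D ∧ (c.tid = b.tid ∨ c.tid = 0) ∧ d = b)

/-- Inserting `b` directly after `w` in modification order. -/
def Graph.moIns (σ : Graph) (w b : TA) : TA → TA → Prop :=
  fun c d => σ.mo c d ∨ ((c = w ∨ σ.mo c w) ∧ d = b) ∨ (c = b ∧ σ.mo w d)

/-- The memory semantics of read and write actions. -/
inductive MemStep : Graph → TA → Graph → Prop where
  | read (σ : Graph) (b w : TA) (x : Loc) (v : Val)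
      (fresh : ∀ c ∈ σ.D, c.tag ≠ b.tag) (hb : b.reads x v)
      (hw : w ∈ σ.OW b.tid) (hv : w.writes x v) :
      MemStep σ b
        { D := insert b σ.D
          sb := σ.sbAdd b
          rf := fun c d => σ.rf c d ∨ (c = w ∧ d = b)
          mo := σ.mo }
  | write (σ : Graph) (b w : TA) (x : Loc) (v u : Val)
      (fresh : ∀ c ∈ σ.D, c.tag ≠ b.tag) (hb : b.writes x v)
      (hw : w ∈ σ.OW b.tid) (hv : w.writes x u) :
      MemStep σ b
        { D := insert b σ.D
          sb := σ.sbAdd b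
          rf := σ.rf
          mo := σ.moIns w b }

/-! ### Configurations and thread-local steps -/

abbrev RegState := Tid → RegFile

/-- State configurations `(σ, γ)`. -/
structure Config where
  σ : Graph
  γ : RegState

/-- `AStep t s γ a γ'`: thread `t` executes the atomic command `s` with action `a`. -/
inductive AStep (t : Tid) : ACom → RegState → Action → RegState → Prop where
  | skip (i : Label) (γ : RegState) : AStep t (.skip i) γ (.loc i) γ
  | store (i : Label) (rel : Bool) (x : Loc) (e : Expr) (γ : RegState) :
      AStep t (.store i rel x e) γ (.wr i rel x (e (γ t))) γ
  | load (i : Label) (acq : Bool) (r : Reg) (x : Loc) (v : Val) (γ : RegState) :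
      AStep t (.load i acq r x) γ (.rd i acq x v)
        (Function.update γ t (Function.update (γ t) r v))
  | assign (i : Label) (r : Reg) (e : Expr) (γ : RegState) :
      AStep t (.assign i r e) γ (.loc i)
        (Function.update γ t (Function.update (γ t) r (e (γ t))))

/-! ### Events and futures -/

/-- An event: an action of a thread together with the actions of that thread that precede it in
program order. Events with the same label after different pasts are different (conflicting). -/
structure Evt where
  tid : Tid
  past : List Action
  act : Action

/-- The program-order runs of a command from a register file: the actions and the resulting register
file. A load may return any value; guards are resolved by the values read. -/
def Com.runs : Com → RegFile → Set (List Action × RegFile)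
  | .done, ρ => {([], ρ)}
  | .atom (.skip i), ρ => {([.loc i], ρ)}
  | .atom (.store i rel x e), ρ => {([.wr i rel x (e ρ)], ρ)}
  | .atom (.load i acq r x), ρ => {p | ∃ v, p = ([.rd i acq x v], Function.update ρ r v)}
  | .atom (.assign i r e), ρ => {([.loc i], Function.update ρ r (e ρ))}
  | .seq c d, ρ => {p | ∃ q ∈ c.runs ρ, ∃ q' ∈ d.runs q.2, p = (q.1 ++ q'.1, q'.2)}
  | .ite b c d, ρ => if b ρ then c.runs ρ else d.runs ρ

/-- A future: a set of events with a (strict) dependency order. -/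
@[ext] structure Future where
  carrier : Set Evt
  prec : Evt → Evt → Prop

/-- The empty future: everything has been executed. -/
def Future.empty : Future := ⟨∅, fun _ _ => False⟩

def Future.restrict (f : Future) (S : Set Evt) : Future where
  carrier := f.carrier ∩ S
  prec e e' := f.prec e e' ∧ e ∈ f.carrier ∩ S ∧ e' ∈ f.carrier ∩ S

/-- `a` labels a minimal event of `f`. -/
def Future.Available (f : Future) (a : Action) : Prop :=
  ∃ e ∈ f.carrier, e.act = a ∧ ∀ e' ∈ f.carrier, ¬ f.prec e' e

/-- The future of `a` in `f`. -/
def Future.consume (a : Action) (f : Future) : Future := f.restrict {e | e.act ≠ a}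

/-- The candidate futures of `a` in `F`. -/
def candidates (a : Action) (F : Set Future) : Set Future :=
  {f' | ∃ f ∈ F, f.Available a ∧ f' = f.consume a}

/-- The future of one run of thread `t`, where `dep` is the dependency order between lines. -/
def runFuture (dep : Label → Label → Prop) (t : Tid) (l : List Action) : Future where
  carrier := {e | e.tid = t ∧ (e.past ++ [e.act]) <+: l}
  prec e e' := (e.tid = t ∧ (e.past ++ [e.act]) <+: l) ∧
    (e'.tid = t ∧ (e'.past ++ [e'.act]) <+: l) ∧ dep e.act.line e'.act.line

def threadFutures (dep : Label → Label → Prop) (t : Tid) (c : Com) : Set Future :=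
  {f | ∃ p ∈ c.runs (fun _ => 0), f = runFuture dep t p.1}

/-- The initial set of futures of a program: one future of each thread, put side by side. -/
def initFutures (dep : Label → Label → Prop) (P : Prog) : Set Future :=
  {f | ∃ φ : Tid → Future, (∀ t, φ t ∈ threadFutures dep t (P t)) ∧
    f = ⟨{e | ∃ t, e ∈ (φ t).carrier}, fun e e' => ∃ t, (φ t).prec e e'⟩}

/-- Restriction of a set of futures to the events of thread `t`. -/
def onThread (F : Set Future) (t : Tid) : Set Future :=
  (fun f => f.restrict {e | e.tid = t}) '' F

/-- The lines that occur in a set of futures. -/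
def lines (F : Set Future) : Set Label := {i | ∃ f ∈ F, ∃ e ∈ f.carrier, e.act.line = i}

/-- All the events of some future have been executed. -/
def Finished (F : Set Future) : Prop := Future.empty ∈ F

/-- `f'` is an up-closed subset of `f`, with the inherited order. -/
def Future.IsUpClosedIn (f' f : Future) : Prop :=
  f'.carrier ⊆ f.carrier ∧ f' = f.restrict f'.carrier ∧
    ∀ e ∈ f'.carrier, ∀ e' ∈ f.carrier, f.prec e e' → e' ∈ f'.carrier

def IsSubFuture (F' F : Set Future) : Prop := ∀ f' ∈ F', ∃ f ∈ F, f'.IsUpClosedIn f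

/-- The sub-program `Q` corresponds to the sub-future `F`. -/
def Corresponds (Q : AtomicSet) (F : Set Future) : Prop := Q.labels = lines F

/-! ### Operational semantics over futures -/

structure State where
  Q : AtomicSet
  C : Config
  F : Set Future

/-- One step: an atomic command still to be executed whose action is available in the futures.
Reads and writes change the memory, internal actions leave it alone. -/
def Step (S S' : State) : Prop :=
  ∃ (t : Tid) (s : ACom) (a : Action),
    s ∈ S.Q t ∧ S'.Q = Function.update S.Q t (S.Q t \ {s}) ∧
    (candidates a S.F).Nonempty ∧ S'.F = candidates a S.F ∧
    AStep t s S.C.γ a S'.C.γ ∧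
    ((∃ g, MemStep S.C.σ ⟨g, a, t⟩ S'.C.σ) ∨ (∃ i, a = .loc i ∧ S'.C.σ = S.C.σ))

/-! ### Hoare triples and Owicki-Gries proof outlines -/

abbrev Pred := Config → Prop
abbrev FuturePred := Set Future → Pred

/-- `{X} Init; P {Y}`. An execution has terminated when all the events of a future have been
consumed; atomic commands in branches that were not taken may remain unexecuted. -/
def HoareTriple (dep : Label → Label → Prop) (Init X : Pred) (P : Prog) (Y : Pred) : Prop :=
  (∀ C, C.σ.WF → Init C → X C) ∧
  ∀ C C' Q' F', C.σ.WF → X C →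
    Relation.ReflTransGen Step ⟨P.atoms, C, initFutures dep P⟩ ⟨Q', C', F'⟩ →
    Finished F' → Y C'

/-- The single-step triple `{I}_G Q {I'}`. -/
def StepTriple (I : FuturePred) (G : Set Future) (Q : AtomicSet) (I' : FuturePred) : Prop :=
  ∀ C C' Q' G', C.σ.WF → I G C → Step ⟨Q, C, G⟩ ⟨Q', C', G'⟩ → I' G' C'

def FutureStable (I : FuturePred) (F : Set Future) (P : AtomicSet) : Prop :=
  ∀ G Q, IsSubFuture G F → Q.IsSub P → Corresponds Q G → StepTriple I G Q I

/-- Validity of an outline that annotates thread `t` with the future predicate `I t`, with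
precondition `X` and postcondition `Y`. -/
structure ValidOutline (dep : Label → Label → Prop) (Init X : Pred) (P : Prog)
    (I : Tid → FuturePred) (Y : Pred) : Prop where
  init_pre : ∀ C, C.σ.WF → Init C → X C
  pre_inv : ∀ C, C.σ.WF → X C → ∀ t, I t (onThread (initFutures dep P) t) C
  inv_post : ∀ C, C.σ.WF → (∀ t, ∃ H, Finished H ∧ I t H C) → Y C
  local_correct : ∀ t, FutureStable (I t) (onThread (initFutures dep P) t) P.atoms
  global_correct : ∀ t₁ t₂, t₁ ≠ t₂ → ∀ F₁ F₂ Q,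
    IsSubFuture F₁ (onThread (initFutures dep P) t₁) →
    IsSubFuture F₂ (onThread (initFutures dep P) t₂) →
    Q.IsSub P.atoms → Corresponds Q F₂ →
    StepTriple (fun H C => I t₁ F₁ C ∧ I t₂ H C) F₂ Q (fun _ C => I t₁ F₁ C)

/-- `H` is what remains of the futures `F` after executing the lines in the list `L`. -/
def Remains (F : Set Future) (L : List Label) (H : Set Future) : Prop :=
  ∃ as : List Action, as.map Action.line = L ∧
    H = as.foldl (fun G a => candidates a G) F ∧ H.Nonempty

/-! ### View assertions -/

/-- `[x = v]_t`: the only write to `x` that `t` can observe has value `v`. -/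
def DefObs (x : Loc) (v : Val) (t : Tid) : Pred := fun C =>
  ∃ w ∈ C.σ.OW t, w.writes x v ∧ ∀ w' ∈ C.σ.OW t, ∀ v', w'.writes x v' → w' = w

/-- `[x ≉ v]_t`: thread `t` cannot observe a write to `x` with value `v`. -/
def NotObs (x : Loc) (v : Val) (t : Tid) : Pred := fun C =>
  ∀ w ∈ C.σ.OW t, ¬ w.writes x v

/-- The graph with just the initialising writes of value `0` to the variables in `V`. -/
def initGraph (V : Set Loc) : Graph where
  D := {b | ∃ x ∈ V, b = ⟨.ini x, .wr 0 false x 0, 0⟩}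
  sb _ _ := False
  rf _ _ := False
  mo _ _ := False

/-! ### The simple LB+data-add+ctrl test -/

def simpleProg : Prog := fun t =>
  if t = 1 then
    .seq (.atom (.load 1 false .r1 .x))
      (.atom (.store 2 false .z (fun ρ => ρ .r1 + 1)))
  else if t = 2 then
    .seq (.atom (.load 3 false .r2 .z))
      (.ite (fun ρ => decide (ρ .r2 = 2)) (.atom (.store 4 false .x (fun _ => 1))) .done)
  else .done

/-- The dependency order `1 ≺ 2`, `3 ≺ 4`. -/
def simpleDep (i j : Label) : Prop := (i = 1 ∧ j = 2) ∨ (i = 3 ∧ j = 4)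

def simpleInit : Pred := fun C =>
  C.σ = initGraph {.x, .z} ∧ C.γ 1 .r1 = 0 ∧ C.γ 2 .r2 = 0

/-- First assertion of thread 1. -/
def simplePre₁ : Pred := fun C =>
  DefObs .z 0 2 C ∧ C.γ 2 .r2 = 0 ∧ ∀ i, i ≠ 0 → NotObs .x i 1 C

/-- First assertion of thread 2. -/
def simplePre₂ : Pred := fun C => ∀ i, i ≠ 0 ∧ i ≠ 1 → NotObs .z i 2 C

def simplePre : Pred := fun C => simplePre₁ C ∧ simplePre₂ C

def simplePost : Pred := fun C => C.γ 1 .r1 ≠ 1 ∨ C.γ 2 .r2 ≠ 2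

/-- The annotations of thread 1, whose initial futures are `F`. -/
def simpleInv₁ (F : Set Future) : FuturePred := fun H C =>
  (Remains F [] H ∧ simplePre₁ C) ∨
  (Remains F [1] H ∧ DefObs .z 0 2 C ∧ C.γ 1 .r1 = 0 ∧ C.γ 2 .r2 = 0) ∨
  (Remains F [1, 2] H ∧ (C.γ 1 .r1 ≠ 1 ∨ C.γ 2 .r2 ≠ 2))

/-- The annotations of thread 2, whose initial futures are `G`. After line 3, the branch has been
entered iff line 4 is still to be executed; the assertion there is `false`. -/
def simpleInv₂ (G : Set Future) : FuturePred := fun H C =>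
  (Remains G [] H ∧ simplePre₂ C) ∨
  (Remains G [3] H ∧ (C.γ 2 .r2 = 0 ∨ C.γ 2 .r2 = 1) ∧ (4 ∈ lines H → False)) ∨
  (Remains G [3, 4] H ∧ True)

def simpleInv : Tid → FuturePred := fun t =>
  if t = 1 then simpleInv₁ (onThread (initFutures simpleDep simpleProg) 1)
  else if t = 2 then simpleInv₂ (onThread (initFutures simpleDep simpleProg) 2)
  else fun _ _ => True

/-! ### The full LB+data-add+ctrl test -/

def fullProg : Prog := fun t =>
  if t = 1 then
    .seq (.atom (.load 1 false .r1 .x)) <|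
    .seq (.atom (.assign 2 .r2 (fun ρ => ρ .r1))) <|
    .seq (.atom (.store 3 false .y (fun ρ => ρ .r2))) <|
    .seq (.atom (.load 4 false .r3 .y))
      (.atom (.store 5 false .z (fun ρ => ρ .r3 + 1)))
  else if t = 2 then
    .seq (.atom (.load 6 false .r4 .z))
      (.ite (fun ρ => decide (ρ .r4 = 2)) (.atom (.store 7 false .x (fun _ => 1))) .done)
  else .done

/-- The dependency order `1 ≺ 2 ≺ 3 ≺ 4 ≺ 5`, `6 ≺ 7`. -/
def fullDep (i j : Label) : Prop := (1 ≤ i ∧ i < j ∧ j ≤ 5) ∨ (i = 6 ∧ j = 7)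

def fullInit : Pred := fun C =>
  C.σ = initGraph {.x, .y, .z} ∧
  C.γ 1 .r1 = 0 ∧ C.γ 1 .r2 = 0 ∧ C.γ 1 .r3 = 0 ∧ C.γ 2 .r4 = 0

def fullPre₁ : Pred := fun C =>
  DefObs .y 0 1 C ∧ DefObs .z 0 2 C ∧ ∀ i, i ≠ 0 → NotObs .x i 1 C

def fullPre₂ : Pred := fun C => ∀ i, i ≠ 0 ∧ i ≠ 1 → NotObs .z i 2 C

def fullPre : Pred := fun C => fullPre₁ C ∧ fullPre₂ C

def fullPost : Pred := fun C => C.γ 1 .r3 ≠ 1 ∨ C.γ 2 .r4 ≠ 2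

def fullInv₁ (F : Set Future) : FuturePred := fun H C =>
  (Remains F [] H ∧ fullPre₁ C) ∨
  (Remains F [1] H ∧ DefObs .y 0 1 C ∧ DefObs .z 0 2 C ∧ C.γ 1 .r1 = 0) ∨
  (Remains F [1, 2] H ∧ DefObs .y 0 1 C ∧ DefObs .z 0 2 C ∧ C.γ 1 .r2 = 0) ∨
  (Remains F [1, 2, 3] H ∧ DefObs .y 0 1 C ∧ DefObs .z 0 2 C) ∨
  (Remains F [1, 2, 3, 4] H ∧ DefObs .z 0 2 C ∧ C.γ 1 .r3 = 0) ∨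
  (Remains F [1, 2, 3, 4, 5] H ∧ C.γ 1 .r3 = 0)

def fullInv₂ (G : Set Future) : FuturePred := fun H C =>
  (Remains G [] H ∧ fullPre₂ C) ∨
  (Remains G [6] H ∧ (C.γ 2 .r4 = 0 ∨ C.γ 2 .r4 = 1) ∧ (7 ∈ lines H → False)) ∨
  (Remains G [6, 7] H ∧ (C.γ 2 .r4 = 0 ∨ C.γ 2 .r4 = 1))

def fullInv : Tid → FuturePred := fun t =>
  if t = 1 then fullInv₁ (onThread (initFutures fullDep fullProg) 1)
  else if t = 2 then fullInv₂ (onThread (initFutures fullDep fullProg) 2)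
  else fun _ _ => True

end MRD

namespace MRD

/-! ### Memory steps -/

/-! The forbidden outcome needs a cycle: the store to `x` is executed only after `2` is read from
`z`, `2` is written to `z` only after `1` is read from `x`, and that `1` can come only from the
store. Semantic dependency orders the lines of each thread, so such a cycle has no first step. The
assertions record this: thread 1 reads `0` from `x` and therefore writes `1` to `z` (in the full
test after passing `0` through `y`); thread 2 cannot observe `2` at `z`, so after its load no
remaining future contains the guarded store, and nothing ever disturbs what thread 1 knows about
`x`.

Three ingredients turn this into a proof.

Memory: a new action only adds encountered writes, so old writes can only cease to be observable
(`MemStep.mem_OW`). A definitely observed write is last in modification order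
(`mo_maximal_of_unique_OW`), so `DefObs` persists until the variable is written again, and after the
observer's own write it holds with the new value.

Composition: a future of the program is a union of thread futures, and labels of threads are
disjoint, so an action affects a single component (`candidates_sideBySide_subset`). This reduces
both validity and the triple to checks of single thread steps (`validOutline_and_hoareTriple`).

Chains: in both tests each action of a run depends on all earlier ones, so the executed actions form
a prefix of a run (`exists_of_mem_foldl_candidates`) and every annotation admits at most one next
line. -/

theorem TA.writes_unique {b : TA} {x y : Loc} {u v : Val} (h : b.writes x u) (h' : b.writes y v) :
    x = y ∧ u = v := by
  obtain ⟨i, r, e⟩ := h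
  obtain ⟨i', r', e'⟩ := h'
  rw [e] at e'
  cases e'
  exact ⟨rfl, rfl⟩

theorem TA.not_writes_of_reads {b : TA} {x y : Loc} {u v : Val} (h : b.reads x u) :
    ¬ b.writes y v := by
  rintro ⟨i', r', e'⟩
  obtain ⟨i, r, e⟩ := h
  rw [e] at e'
  cases e'

/-- `hb`, `fr` and `eco` are positive in the basic relations: the only negative clause, `r ≠ w'` in
`fr`, does not mention the graph. -/
theorem Graph.EW_mono {σ σ' : Graph} (hD : σ.D ⊆ σ'.D) (hsb : ∀ c d, σ.sb c d → σ'.sb c d)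
    (hrf : ∀ c d, σ.rf c d → σ'.rf c d) (hmo : ∀ c d, σ.mo c d → σ'.mo c d) (t : Tid) :
    σ.EW t ⊆ σ'.EW t := by
  rintro w ⟨hw, hwr, b, hb, hbt, c, hwc, hcb⟩
  refine ⟨hD hw, hwr, b, hD hb, hbt, c, hwc.mono ?_, hcb.mono ?_⟩
  · intro p q h
    refine Relation.TransGen.mono ?_ _ _ h
    rintro p q (h | h | ⟨⟨w, h₁, h₂⟩, h₃⟩)
    · exact .inl (hrf _ _ h)
    · exact .inr (.inl (hmo _ _ h))
    · exact .inr (.inr ⟨⟨w, hrf _ _ h₁, hmo _ _ h₂⟩, h₃⟩)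
  · intro p q h
    refine Relation.TransGen.mono ?_ _ _ h
    rintro p q (h | ⟨h₁, h₂⟩)
    · exact .inl (hsb _ _ h)
    · exact .inr ⟨hrf _ _ h₁, h₂⟩

namespace MemStep

variable {σ σ' : Graph} {b : TA}

theorem dom_eq (h : MemStep σ b σ') : σ'.D = insert b σ.D := by
  cases h <;> rfl

theorem notMem (h : MemStep σ b σ') : b ∉ σ.D := by
  cases h with
  | read w x v fresh _ _ _ => exact fun hb => fresh b hb rfl
  | write w x v u fresh _ _ _ => exact fun hb => fresh b hb rfl

theorem mo_mono (h : MemStep σ b σ') {c d : TA} (hcd : σ.mo c d) : σ'.mo c d := by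
  cases h with
  | read => exact hcd
  | write => exact .inl hcd

/-- New modification-order edges have the new action at one end. -/
theorem mo_cases (h : MemStep σ b σ') {c d : TA} (hcd : σ'.mo c d) :
    σ.mo c d ∨ c = b ∨ d = b := by
  cases h with
  | read => exact .inl hcd
  | write =>
    rcases hcd with h | ⟨_, h⟩ | ⟨h, _⟩
    · exact .inl h
    · exact .inr (.inr h)
    · exact .inr (.inl h)

theorem EW_subset (h : MemStep σ b σ') (t : Tid) : σ.EW t ⊆ σ'.EW t := by
  have hD : σ.D ⊆ σ'.D := by rw [h.dom_eq]; exact Set.subset_insert _ _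
  refine Graph.EW_mono hD ?_ ?_ (fun _ _ => h.mo_mono) t
  · cases h <;> exact fun _ _ => Or.inl
  · cases h with
    | read => exact fun _ _ => Or.inl
    | write => exact fun _ _ => id

/-- An encountered write that hides `w` stays encountered and stays after `w`, so no old write
becomes observable again. -/
theorem mem_OW (h : MemStep σ b σ') {t : Tid} {w : TA} (hw : w ∈ σ'.OW t) :
    w = b ∨ w ∈ σ.OW t := by
  obtain ⟨hD, hwr, hobs⟩ := hw
  rw [h.dom_eq] at hD
  rcases hD with rfl | hD
  · exact .inl rfl
  · exact .inr ⟨hD, hwr, fun w' hw' hmo => hobs w' (h.EW_subset t hw') (h.mo_mono hmo)⟩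

/-- For a write, the old writes to its variable are cut into those up to `w` and those after `w`,
and the new one is placed at the cut. -/
theorem wf (h : MemStep σ b σ') (W : σ.WF) : σ'.WF := by
  have hb := h.notMem
  have sbD : ∀ c d, σ.sbAdd b c d →
      c ∈ insert b σ.D ∧ d ∈ insert b σ.D ∧ (c.tid = d.tid ∨ c.tid = 0) := by
    rintro c d (h | ⟨hc, ht, rfl⟩)
    · obtain ⟨h₁, h₂, h₃⟩ := W.sbDom _ _ h
      exact ⟨.inr h₁, .inr h₂, h₃⟩
    · exact ⟨.inr hc, .inl rfl, ht⟩
  have tagI (fresh : ∀ c ∈ σ.D, c.tag ≠ b.tag) :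
      ∀ c ∈ insert b σ.D, ∀ d ∈ insert b σ.D, c.tag = d.tag → c = d := by
    rintro c (rfl | hc) d (rfl | hd) e
    · rfl
    · exact absurd e.symm (fresh _ hd)
    · exact absurd e (fresh _ hc)
    · exact W.tagInj _ hc _ hd e
  cases h with
  | read w x v fresh hrd hw hv =>
    refine ⟨?_, tagI fresh, sbD, ?_, ?_, ?_, W.moIrrefl, W.moTrans, ?_⟩
    · rintro c (rfl | hc)
      · exact .inl ⟨x, v, hrd⟩
      · exact W.memAct c hc
    · rintro c d (h | ⟨rfl, rfl⟩)
      · obtain ⟨h₁, h₂, h₃⟩ := W.rfDom _ _ h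
        exact ⟨.inr h₁, .inr h₂, h₃⟩
      · exact ⟨.inr hw.1, .inl rfl, x, v, hv, hrd⟩
    · rintro c c' d (h | ⟨rfl, rfl⟩) (h' | ⟨h₁, h₂⟩)
      · exact W.rfFun _ _ _ h h'
      · subst h₂; exact absurd (W.rfDom _ _ h).2.1 hb
      · exact absurd (W.rfDom _ _ h').2.1 hb
      · exact h₁.symm
    · intro c d h
      obtain ⟨h₁, h₂, h₃⟩ := W.moDom _ _ h
      exact ⟨.inr h₁, .inr h₂, h₃⟩
    · rintro c (rfl | hc) d (rfl | hd) y u u' hcw hdw hne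
      · exact absurd rfl hne
      · exact absurd hcw (TA.not_writes_of_reads hrd)
      · exact absurd hdw (TA.not_writes_of_reads hrd)
      · exact W.moTotal _ hc _ hd y u u' hcw hdw hne
  | write w x v u fresh hwr hw hv =>
    have hL : ∀ d, ¬ σ.mo b d := fun d h => hb (W.moDom _ _ h).1
    have hR : ∀ d, ¬ σ.mo d b := fun d h => hb (W.moDom _ _ h).2.1
    have hwb : w ≠ b := fun h => hb (h ▸ hw.1)
    refine ⟨?_, tagI fresh, sbD, ?_, W.rfFun, ?_, ?_, ?_, ?_⟩
    · rintro c (rfl | hc)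
      · exact .inr ⟨x, v, hwr⟩
      · exact W.memAct c hc
    · intro c d h
      obtain ⟨h₁, h₂, h₃⟩ := W.rfDom _ _ h
      exact ⟨.inr h₁, .inr h₂, h₃⟩
    · rintro c d (h | ⟨rfl | h, rfl⟩ | ⟨rfl, h⟩)
      · obtain ⟨h₁, h₂, h₃⟩ := W.moDom _ _ h
        exact ⟨.inr h₁, .inr h₂, h₃⟩
      · exact ⟨.inr hw.1, .inl rfl, x, u, v, hv, hwr⟩
      · obtain ⟨h₁, -, y, u₁, u₂, h₂, h₃⟩ := W.moDom _ _ h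
        obtain ⟨rfl, rfl⟩ := TA.writes_unique h₃ hv
        exact ⟨.inr h₁, .inl rfl, y, u₁, v, h₂, hwr⟩
      · obtain ⟨-, h₁, y, u₁, u₂, h₂, h₃⟩ := W.moDom _ _ h
        obtain ⟨rfl, rfl⟩ := TA.writes_unique h₂ hv
        exact ⟨.inl rfl, .inr h₁, y, v, u₂, hwr, h₃⟩
    · rintro c (h | ⟨rfl | h, h'⟩ | ⟨rfl, h⟩)
      · exact W.moIrrefl _ h
      · exact hwb h'
      · subst h'; exact hL _ h
      · exact hR _ h
    -- Nine cases, by the kind of each edge. A path that passes through `b` composes to an old edge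
    -- across `w`; a path from `b` back to `b` would give a cycle at `w`.
    · rintro c d e (h | ⟨h, rfl⟩ | ⟨rfl, h⟩) (h' | ⟨h', rfl⟩ | ⟨h'', h'⟩)
      · exact .inl (W.moTrans _ _ _ h h')
      · refine .inr (.inl ⟨.inr ?_, rfl⟩)
        rcases h' with rfl | h'
        · exact h
        · exact W.moTrans _ _ _ h h'
      · subst h''; exact absurd h (hR _)
      · exact absurd h' (hL _)
      · exact .inr (.inl ⟨h, rfl⟩)
      · rcases h with rfl | h
        · exact .inl h'
        · exact .inl (W.moTrans _ _ _ h h')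
      · exact .inr (.inr ⟨rfl, W.moTrans _ _ _ h h'⟩)
      · rcases h' with rfl | h'
        · exact absurd h (W.moIrrefl _)
        · exact absurd (W.moTrans _ _ _ h h') (W.moIrrefl _)
      · exact .inr (.inr ⟨rfl, h'⟩)
    · have key : ∀ c ∈ σ.D, ∀ y p q, c.writes y p → b.writes y q →
          (c = w ∨ σ.mo c w) ∨ σ.mo w c := by
        intro c hc y p q hcw hbw
        obtain ⟨rfl, rfl⟩ := TA.writes_unique hbw hwr
        by_cases hcw' : c = w
        · exact .inl (.inl hcw')
        · rcases W.moTotal _ hc _ hw.1 _ _ _ hcw hv hcw' with h | h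
          · exact .inl (.inr h)
          · exact .inr h
      rintro c (rfl | hc) d (rfl | hd) y p q hcw hdw hne
      · exact absurd rfl hne
      · rcases key _ hd _ _ _ hdw hcw with h | h
        · exact .inr (.inr (.inl ⟨h, rfl⟩))
        · exact .inl (.inr (.inr ⟨rfl, h⟩))
      · rcases key _ hc _ _ _ hcw hdw with h | h
        · exact .inl (.inr (.inl ⟨h, rfl⟩))
        · exact .inr (.inr (.inr ⟨rfl, h⟩))
      · rcases W.moTotal _ hc _ hd y p q hcw hdw hne with h | h
        · exact .inl (.inl h)
        · exact .inr (.inl h)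

end MemStep

/-! ### Memory effect of an action on configurations and view assertions -/

section

/-- The memory of `C'` results from that of `C` by action `a` of thread `t`. -/
def MemEffect (t : Tid) (a : Action) (C C' : Config) : Prop :=
  (∃ g, MemStep C.σ ⟨g, a, t⟩ C'.σ) ∨ (∃ i, a = .loc i ∧ C'.σ = C.σ)

variable {t u : Tid} {a : Action} {C C' : Config} {x : Loc} {v : Val}

theorem MemEffect.wf (h : MemEffect t a C C') (W : C.σ.WF) : C'.σ.WF := by
  rcases h with ⟨g, h⟩ | ⟨i, -, h⟩
  · exact h.wf W
  · rwa [h]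

theorem NotObs.of_memEffect (h : MemEffect t a C C') (ha : ∀ i r, a ≠ .wr i r x v)
    (hC : NotObs x v u C) : NotObs x v u C' := by
  rcases h with ⟨g, h⟩ | ⟨i, -, h⟩
  · intro w hw hwr
    rcases h.mem_OW hw with rfl | hw
    · obtain ⟨i, r, e⟩ := hwr
      exact ha i r e
    · exact hC w hw hwr
  · unfold NotObs
    rwa [h]

/-- A definitely observed write is last in modification order. -/
theorem mo_maximal_of_unique_OW {σ : Graph} (W : σ.WF) {w : TA} (hw : w ∈ σ.OW t)
    (hx : w.writes x v) (huniq : ∀ w' ∈ σ.OW t, ∀ v', w'.writes x v' → w' = w) (w' : TA) :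
    ¬ σ.mo w w' := by
  intro hmo
  obtain ⟨-, hD, y, p, q, hp, hq⟩ := W.moDom _ _ hmo
  obtain ⟨rfl, rfl⟩ := TA.writes_unique hp hx
  by_cases hw' : w' ∈ σ.OW t
  · have := huniq w' hw' q hq
    subst this
    exact W.moIrrefl _ hmo
  · refine hw' ⟨hD, ⟨y, q, hq⟩, fun w'' hw'' hmo' => ?_⟩
    exact hw.2.2 w'' hw'' (W.moTrans _ _ _ hmo hmo')

/-- New modification-order edges have the new action at one end, and it is not a write to `x`. So
the observed write stays maximal, hence observable, whichever thread acts. -/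
theorem DefObs.of_memEffect (W : C.σ.WF) (h : MemEffect t a C C') (ha : ∀ i r v, a ≠ .wr i r x v)
    (hC : DefObs x v u C) : DefObs x v u C' := by
  rcases h with ⟨g, h⟩ | ⟨i, -, h⟩
  · obtain ⟨w, hw, hx, huniq⟩ := hC
    have hmax := mo_maximal_of_unique_OW W hw hx huniq
    have hbx : ∀ v', ¬ TA.writes ⟨g, a, t⟩ x v' := fun v' ⟨i, r, e⟩ => ha i r v' e
    have hwD : w ∈ C'.σ.D := by rw [h.dom_eq]; exact .inr hw.1
    refine ⟨w, ⟨hwD, hw.2.1, fun w' _ hmo => ?_⟩, hx, fun w' hw' v' hx' => ?_⟩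
    · obtain ⟨-, -, y, p, q, hp, hq⟩ := (h.wf W).moDom _ _ hmo
      obtain ⟨rfl, rfl⟩ := TA.writes_unique hp hx
      rcases h.mo_cases hmo with hmo | rfl | rfl
      · exact hmax _ hmo
      · exact hbx _ hp
      · exact hbx _ hq
    · rcases h.mem_OW hw' with rfl | hw'
      · exact absurd hx' (hbx v')
      · exact huniq w' hw' v' hx'
  · unfold DefObs
    rwa [h]

/-- After overwriting the definitely observed write, a thread definitely observes its own write. -/
theorem DefObs.of_write {i : Label} {r : Bool} {p : Val} (W : C.σ.WF)
    (h : MemEffect t (.wr i r x p) C C') (hC : DefObs x v t C) : DefObs x p t C' := by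
  rcases h with ⟨g, h⟩ | ⟨i, h, -⟩
  · obtain ⟨w, hw, hx, huniq⟩ := hC
    have hmax := mo_maximal_of_unique_OW W hw hx huniq
    have hbx : TA.writes ⟨g, .wr i r x p, t⟩ x p := ⟨i, r, rfl⟩
    have W' := h.wf W
    have hbD : (⟨g, .wr i r x p, t⟩ : TA) ∈ C'.σ.D := by rw [h.dom_eq]; exact .inl rfl
    have hmax' : ∀ w', ¬ C'.σ.mo ⟨g, .wr i r x p, t⟩ w' := by
      intro w' hmo
      have hb := h.notMem
      generalize C'.σ = σ' at *
      cases h with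
      | read _ _ _ _ hrd => exact TA.not_writes_of_reads hrd hbx
      | write w₀ y p' q _ hb' hw₀ hq =>
        obtain ⟨rfl, rfl⟩ := TA.writes_unique hbx hb'
        -- The insertion point is observable, so it is the definitely observed write. Nothing
        -- follows that write, so the new one is last.
        obtain rfl := huniq _ hw₀ _ hq
        rcases hmo with h | ⟨h | h, -⟩ | ⟨-, h⟩
        · exact hb (W.moDom _ _ h).1
        · exact hb (h ▸ hw.1)
        · exact hb (W.moDom _ _ h).1
        · exact hmax _ h
    refine ⟨_, ⟨hbD, ⟨x, p, hbx⟩, fun w' _ => hmax' w'⟩, hbx, fun w' hw' v' hx' => ?_⟩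
    by_contra hne
    rcases W'.moTotal _ hw'.1 _ hbD x v' p hx' hbx hne with hmo | hmo
    -- A thread encounters its own write through the reflexive closures, so everything before that
    -- write is hidden.
    · exact hw'.2.2 _ ⟨hbD, ⟨x, p, hbx⟩, _, hbD, rfl, _, .refl, .refl⟩ hmo
    · exact hmax' _ hmo
  · cases h

/-- A thread can read only values it can observe. -/
theorem exists_OW_of_read {i : Label} {q : Bool} (h : MemEffect t (.rd i q x v) C C') :
    ∃ w ∈ C.σ.OW t, w.writes x v := by
  rcases h with ⟨g, h⟩ | ⟨i, h, -⟩
  · generalize C'.σ = σ' at *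
    cases h with
    | read w y v' _ hb hw hv =>
      obtain ⟨i', q', e⟩ := hb
      cases e
      exact ⟨w, hw, hv⟩
    | write w y v' _ _ hb =>
      obtain ⟨i', q', e⟩ := hb
      cases e
  · cases h

theorem DefObs.read_eq {i : Label} {q : Bool} {p : Val} (h : MemEffect t (.rd i q x p) C C')
    (hC : DefObs x v t C) : p = v := by
  obtain ⟨w, hw, hx⟩ := exists_OW_of_read h
  obtain ⟨w', hw', hx', huniq⟩ := hC
  obtain rfl := huniq w hw _ hx
  exact (TA.writes_unique hx hx').2

theorem NotObs.read_ne {i : Label} {q : Bool} {p : Val} (h : MemEffect t (.rd i q x p) C C')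
    (hC : NotObs x v t C) : p ≠ v := by
  rintro rfl
  obtain ⟨w, hw, hx⟩ := exists_OW_of_read h
  exact hC w hw hx

/-! ### The initial graph -/

theorem initGraph_OW {V : Set Loc} {w : TA} :
    w ∈ (initGraph V).OW t ↔ ∃ y ∈ V, w = ⟨.ini y, .wr 0 false y 0, 0⟩ := by
  constructor
  · exact fun h => h.1
  · rintro ⟨y, hy, rfl⟩
    exact ⟨⟨y, hy, rfl⟩, ⟨y, 0, 0, false, rfl⟩, fun _ _ h => h⟩

theorem defObs_initGraph {V : Set Loc} (hC : C.σ = initGraph V) (hx : x ∈ V) :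
    DefObs x 0 t C := by
  unfold DefObs
  rw [hC]
  refine ⟨⟨.ini x, .wr 0 false x 0, 0⟩, initGraph_OW.2 ⟨x, hx, rfl⟩, ⟨0, false, rfl⟩, ?_⟩
  intro w' hw' v' hv'
  obtain ⟨y, -, rfl⟩ := initGraph_OW.1 hw'
  obtain ⟨i, r, e⟩ := hv'
  cases e
  rfl

theorem notObs_initGraph {V : Set Loc} (hC : C.σ = initGraph V) (hv : v ≠ 0) :
    NotObs x v t C := by
  unfold NotObs
  rw [hC]
  intro w hw hwr
  obtain ⟨y, -, rfl⟩ := initGraph_OW.1 hw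
  obtain ⟨i, r, e⟩ := hwr
  cases e
  exact hv rfl

end

/-! ### Futures of threads -/

theorem Com.runs_nonempty (c : Com) (ρ : RegFile) : (c.runs ρ).Nonempty := by
  induction c generalizing ρ with
  | done => exact ⟨_, rfl⟩
  | atom s =>
    cases s with
    | load i q r x => exact ⟨_, 0, rfl⟩
    | _ => exact ⟨_, rfl⟩
  | seq c d hc hd =>
    obtain ⟨q, hq⟩ := hc ρ
    obtain ⟨q', hq'⟩ := hd q.2
    exact ⟨_, q, hq, q', hq', rfl⟩
  | ite b c d hc hd =>
    rw [Com.runs]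
    split_ifs
    exacts [hc ρ, hd ρ]

/-- An `Action` carries its line but no thread. Tying the line to a command of the program lets
disjointness of labels recover the thread. -/
theorem Com.exists_atom_of_mem_run {c : Com} {ρ : RegFile} {p : List Action × RegFile}
    (hp : p ∈ c.runs ρ) {b : Action} (hb : b ∈ p.1) : ∃ s ∈ c.atoms, s.label = b.line := by
  induction c generalizing ρ p with
  | done =>
    obtain rfl : p = _ := hp
    cases hb
  | atom s =>
    refine ⟨s, rfl, ?_⟩
    cases s with
    | load i q r x =>
      obtain ⟨v, rfl⟩ := hp
      rw [List.mem_singleton.1 hb]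
      rfl
    | _ =>
      obtain rfl : p = _ := hp
      rw [List.mem_singleton.1 hb]
      rfl
  | seq c d hc hd =>
    obtain ⟨q, hq, q', hq', rfl⟩ := hp
    rcases List.mem_append.1 hb with hb | hb
    · obtain ⟨s, hs, e⟩ := hc hq hb
      exact ⟨s, .inl hs, e⟩
    · obtain ⟨s, hs, e⟩ := hd hq' hb
      exact ⟨s, .inr hs, e⟩
  | ite g c d hc hd =>
    rw [Com.runs] at hp
    split_ifs at hp
    · obtain ⟨s, hs, e⟩ := hc hp hb
      exact ⟨s, .inl hs, e⟩
    · obtain ⟨s, hs, e⟩ := hd hp hb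
      exact ⟨s, .inr hs, e⟩

/-- `f` consists of events of thread `t` of `P`, and its order lives on its events. -/
structure Future.OfThread (P : Prog) (t : Tid) (f : Future) : Prop where
  tid_eq : ∀ e ∈ f.carrier, e.tid = t
  exists_atom : ∀ e ∈ f.carrier, ∃ s ∈ P.atoms t, s.label = e.act.line
  prec_mem : ∀ e e', f.prec e e' → e ∈ f.carrier ∧ e' ∈ f.carrier

theorem Future.OfThread.restrict {P : Prog} {t : Tid} {f : Future} (h : f.OfThread P t)
    (S : Set Evt) : (f.restrict S).OfThread P t :=
  ⟨fun e he => h.tid_eq e he.1, fun e he => h.exists_atom e he.1, fun _ _ he => he.2⟩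

theorem mem_of_mem_runFuture {dep : Label → Label → Prop} {t : Tid} {l : List Action} {e : Evt}
    (he : e ∈ (runFuture dep t l).carrier) : e.act ∈ l :=
  he.2.subset (by simp)

theorem ofThread_of_mem_threadFutures {dep : Label → Label → Prop} {P : Prog} {t : Tid}
    {f : Future} (hf : f ∈ threadFutures dep t (P t)) : f.OfThread P t := by
  obtain ⟨p, hp, rfl⟩ := hf
  exact ⟨fun e he => he.1, fun e he => Com.exists_atom_of_mem_run hp (mem_of_mem_runFuture he),
    fun e e' he => ⟨he.1, he.2.1⟩⟩

/-- The union of a family of futures. -/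
def Future.union (φ : Tid → Future) : Future :=
  ⟨{e | ∃ t, e ∈ (φ t).carrier}, fun d e => ∃ t, (φ t).prec d e⟩

/-- The futures obtained by choosing one future for each thread. -/
def sideBySide (H : Tid → Set Future) : Set Future :=
  {f | ∃ φ : Tid → Future, (∀ t, φ t ∈ H t) ∧ f = Future.union φ}

theorem initFutures_eq (dep : Label → Label → Prop) (P : Prog) :
    initFutures dep P = sideBySide fun t => threadFutures dep t (P t) := rfl

/-- Events carry their thread, so the components of the union are disjoint; `prec_mem` places each
order edge in the component of its endpoints. -/
theorem Future.union_restrict_tid {P : Prog} {φ : Tid → Future}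
    (hφ : ∀ t, (φ t).OfThread P t) (t : Tid) :
    (Future.union φ).restrict {e | e.tid = t} = φ t := by
  have key : ∀ e t', e ∈ (φ t').carrier → e.tid = t → e ∈ (φ t).carrier := by
    intro e t' he ht
    have := (hφ t').tid_eq e he
    subst ht this
    exact he
  ext e
  · exact ⟨fun ⟨⟨t', he⟩, ht⟩ => key e t' he ht, fun he => ⟨⟨t, he⟩, (hφ t).tid_eq e he⟩⟩
  · rename_i e'
    constructor
    · rintro ⟨⟨t', hp⟩, ⟨-, h₁⟩, -⟩
      obtain rfl : e.tid = t := h₁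
      rwa [(hφ t').tid_eq e ((hφ t').prec_mem _ _ hp).1]
    · intro hp
      obtain ⟨h₁, h₂⟩ := (hφ t).prec_mem _ _ hp
      exact ⟨⟨t, hp⟩, ⟨⟨t, h₁⟩, (hφ t).tid_eq e h₁⟩, ⟨⟨t, h₂⟩, (hφ t).tid_eq e' h₂⟩⟩

theorem onThread_initFutures (dep : Label → Label → Prop) (P : Prog) (t : Tid) :
    onThread (initFutures dep P) t = threadFutures dep t (P t) := by
  ext f
  constructor
  · rintro ⟨_, ⟨φ, hφ, rfl⟩, rfl⟩
    have := Future.union_restrict_tid (fun t => ofThread_of_mem_threadFutures (hφ t)) t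
    have h := hφ t
    rw [← this] at h
    exact h
  · intro hf
    -- A future of one thread extends to a future of the program by an arbitrary run of every other
    -- thread.
    choose p hp using fun t => Com.runs_nonempty (P t) fun _ => 0
    let φ : Tid → Future := Function.update (fun t => runFuture dep t (p t).1) t f
    have hφ : ∀ t, φ t ∈ threadFutures dep t (P t) := by
      intro t'
      by_cases h : t' = t
      · subst h
        simpa [φ] using hf
      · simpa [φ, h] using ⟨_, hp t', rfl⟩
    refine ⟨Future.union φ, ⟨φ, hφ, rfl⟩, ?_⟩
    have := Future.union_restrict_tid (fun t => ofThread_of_mem_threadFutures (hφ t)) t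
    simpa [φ] using this

theorem Future.union_consume {P : Prog} {φ : Tid → Future} (hφ : ∀ t, (φ t).OfThread P t)
    (a : Action) : (Future.union φ).consume a = Future.union fun t => (φ t).consume a := by
  ext e
  · exact ⟨fun ⟨⟨t, h₁⟩, h₂⟩ => ⟨t, h₁, h₂⟩, fun ⟨t, h₁, h₂⟩ => ⟨⟨t, h₁⟩, h₂⟩⟩
  · constructor
    · rintro ⟨⟨t, hp⟩, ⟨-, h₁⟩, ⟨-, h₂⟩⟩
      obtain ⟨h₃, h₄⟩ := (hφ t).prec_mem _ _ hp
      exact ⟨t, hp, ⟨h₃, h₁⟩, ⟨h₄, h₂⟩⟩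
    · rintro ⟨t, hp, ⟨h₁, h₂⟩, ⟨h₃, h₄⟩⟩
      exact ⟨⟨t, hp⟩, ⟨⟨t, h₁⟩, h₂⟩, ⟨⟨t, h₃⟩, h₄⟩⟩

theorem Future.consume_eq_self {P : Prog} {t : Tid} {f : Future} (hf : f.OfThread P t)
    {a : Action} (ha : ∀ e ∈ f.carrier, e.act ≠ a) : f.consume a = f := by
  ext e
  · exact ⟨fun h => h.1, fun h => ⟨h, ha e h⟩⟩
  · constructor
    · exact fun h => h.1
    · intro h
      obtain ⟨h₁, h₂⟩ := hf.prec_mem _ _ h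
      exact ⟨h, ⟨h₁, ha _ h₁⟩, ⟨h₂, ha _ h₂⟩⟩

/-- Different threads use different line labels. -/
def Prog.LabelsDisjoint (P : Prog) : Prop :=
  ∀ t t', ∀ s ∈ P.atoms t, ∀ s' ∈ P.atoms t', s.label = s'.label → t = t'

/-- The line of `a` belongs to thread `t` alone, so the available event lies in component `t`, where
it is still minimal, and consuming `a` leaves the other components as they are. -/
theorem candidates_sideBySide_subset {P : Prog} (hP : P.LabelsDisjoint) {H : Tid → Set Future}
    (hH : ∀ t, ∀ f ∈ H t, f.OfThread P t) {t : Tid} {s : ACom} (hs : s ∈ P.atoms t) {a : Action}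
    (ha : s.label = a.line) :
    candidates a (sideBySide H) ⊆ sideBySide (Function.update H t (candidates a (H t))) := by
  rintro _ ⟨_, ⟨φ, hφ, rfl⟩, hav, rfl⟩
  have hT : ∀ t, (φ t).OfThread P t := fun t => hH t _ (hφ t)
  have huniq : ∀ t', ∀ e ∈ (φ t').carrier, e.act = a → t' = t := by
    rintro t' e he rfl
    obtain ⟨s', hs', e'⟩ := (hT t').exists_atom e he
    exact hP _ _ s' hs' s hs (e'.trans ha.symm)
  refine ⟨fun t => (φ t).consume a, fun t' => ?_, Future.union_consume hT a⟩
  by_cases h : t' = t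
  · subst h
    rw [Function.update_self]
    obtain ⟨e, ⟨t'', he⟩, hea, hmin⟩ := hav
    obtain rfl := huniq t'' e he hea
    exact ⟨_, hφ _, ⟨e, he, hea, fun e' he' hp => hmin e' ⟨_, he'⟩ ⟨_, hp⟩⟩, rfl⟩
  · rw [Function.update_of_ne h]
    simp only
    rw [Future.consume_eq_self (hT t') fun e he hea => h (huniq t' e he hea)]
    exact hφ t'

theorem finished_of_finished_sideBySide {P : Prog} {H : Tid → Set Future}
    (hH : ∀ t, ∀ f ∈ H t, f.OfThread P t) (h : Finished (sideBySide H)) (t : Tid) :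
    Finished (H t) := by
  obtain ⟨φ, hφ, h⟩ := h
  have : φ t = Future.empty := by
    have hc : ∀ e, e ∉ (φ t).carrier := by
      intro e he
      have : e ∈ Future.empty.carrier := by rw [h]; exact ⟨t, he⟩
      exact this
    ext e
    · exact ⟨fun he => hc e he, fun he => he.elim⟩
    · exact ⟨fun hp => hc e ((hH t _ (hφ t)).prec_mem _ _ hp).1, fun hp => hp.elim⟩
  have h := hφ t
  rw [this] at h
  exact h

/-! ### Soundness of outlines -/

/-- Thread `t` of `P` executes one of its atomic commands with action `a`. -/
def ThreadStep (P : Prog) (t : Tid) (a : Action) (C C' : Config) : Prop :=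
  (∃ s ∈ P.atoms t, AStep t s C.γ a C'.γ) ∧ MemEffect t a C C'

theorem AStep.label_eq {t : Tid} {s : ACom} {γ γ' : RegState} {a : Action}
    (h : AStep t s γ a γ') : s.label = a.line := by
  cases h <;> rfl

/-- The action labels an event of thread `t`, so its line is one of `t`; disjoint labels then make
`t` the acting thread, although `Q` may hold commands of other threads. -/
theorem Step.threadStep {dep : Label → Label → Prop} {P : Prog} (hP : P.LabelsDisjoint) {t : Tid}
    {Q Q' : AtomicSet} {C C' : Config} {G G' : Set Future}
    (hG : IsSubFuture G (onThread (initFutures dep P) t)) (hQ : Q.IsSub P.atoms)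
    (h : Step ⟨Q, C, G⟩ ⟨Q', C', G'⟩) :
    ∃ a, ThreadStep P t a C C' ∧ (candidates a G).Nonempty ∧ G' = candidates a G := by
  obtain ⟨t', s, a, hs, -, hne, heq, hA, hM⟩ := h
  obtain ⟨_, f', hf', ⟨e, he, rfl, -⟩, -⟩ := id hne
  obtain ⟨f, hf, hsub, -⟩ := hG f' hf'
  rw [onThread_initFutures] at hf
  obtain ⟨s', hs', e'⟩ := (ofThread_of_mem_threadFutures hf).exists_atom e (hsub he)
  obtain rfl := hP _ _ s (hQ _ hs) s' hs' (hA.label_eq.trans e'.symm)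
  exact ⟨_, ⟨⟨s, hQ _ hs, hA⟩, hM⟩, hne, heq⟩

/-- An outline that is locally and globally correct for all thread steps is valid and sound. -/
theorem validOutline_and_hoareTriple {dep : Label → Label → Prop} {Init X Y : Pred} {P : Prog}
    {I : Tid → FuturePred} (hP : P.LabelsDisjoint) (init_pre : ∀ C, Init C → X C)
    (pre_inv : ∀ C, X C → ∀ t, I t (threadFutures dep t (P t)) C)
    (inv_post : ∀ C, (∀ t, ∃ H, Finished H ∧ I t H C) → Y C)
    (hloc : ∀ t a C C' G, C.σ.WF → ThreadStep P t a C C' → (candidates a G).Nonempty →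
      I t G C → I t (candidates a G) C')
    (hglob : ∀ t₁ t₂ a C C' F G, t₁ ≠ t₂ → C.σ.WF → ThreadStep P t₂ a C C' →
      (candidates a G).Nonempty → I t₁ F C → I t₂ G C → I t₁ F C') :
    ValidOutline dep Init X P I Y ∧ HoareTriple dep Init X P Y := by
  refine ⟨⟨fun C _ => init_pre C, fun C _ hX t => ?_, fun C _ => inv_post C, ?_, ?_⟩,
    fun C _ => init_pre C, ?_⟩
  · rw [onThread_initFutures]
    exact pre_inv C hX t
  · intro t G Q hG hQ _ C C' Q' G' W hI hstep
    obtain ⟨a, hT, hne, rfl⟩ := hstep.threadStep hP hG hQ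
    exact hloc t a C C' G W hT hne hI
  · intro t₁ t₂ ht F₁ F₂ Q _ hF₂ hQ _ C C' Q' G' W hI hstep
    obtain ⟨a, hT, hne, rfl⟩ := hstep.threadStep hP hF₂ hQ
    exact hglob t₁ t₂ a C C' F₁ F₂ ht W hT hne hI.1 hI.2
  · intro C C' Q' F' W hX hsteps hfin
    -- The invariant along an execution: the current futures lie in the side-by-side product of
    -- thread futures `H t` at which the assertions hold. Inclusion is enough, since `candidates`
    -- and `Finished` are monotone in the set of futures.
    suffices h : ∀ S, Relation.ReflTransGen Step ⟨P.atoms, C, initFutures dep P⟩ S →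
        S.Q.IsSub P.atoms ∧ S.C.σ.WF ∧ ∃ H : Tid → Set Future,
          (∀ t, ∀ f ∈ H t, f.OfThread P t) ∧ S.F ⊆ sideBySide H ∧ ∀ t, I t (H t) S.C by
      obtain ⟨-, -, H, hH, hF, hI⟩ := h _ hsteps
      exact inv_post C' fun t => ⟨H t, finished_of_finished_sideBySide hH (hF hfin) t, hI t⟩
    intro S hS
    induction hS with
    | refl =>
      exact ⟨fun _ => subset_rfl, W, _, fun t f hf => ofThread_of_mem_threadFutures hf,
        (initFutures_eq dep P).subset, pre_inv C hX⟩
    | @tail S S' _ hstep ih =>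
      obtain ⟨hQ, W, H, hH, hF, hI⟩ := ih
      obtain ⟨t, s, a, hs, hQ', hne, hF', hA, hM⟩ := hstep
      have hsub : candidates a S.F ⊆ sideBySide (Function.update H t (candidates a (H t))) := by
        refine subset_trans ?_ (candidates_sideBySide_subset hP hH (hQ t hs) hA.label_eq)
        rintro _ ⟨f, hf, h⟩
        exact ⟨f, hF hf, h⟩
      have hne' : (candidates a (H t)).Nonempty := by
        obtain ⟨f, hf⟩ := hne
        obtain ⟨φ, hφ, -⟩ := hsub hf
        exact ⟨φ t, by simpa using hφ t⟩
      have hT : ThreadStep P t a S.C S'.C := ⟨⟨s, hQ t hs, hA⟩, hM⟩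
      refine ⟨?_, MemEffect.wf hM W, _, ?_, hF' ▸ hsub, ?_⟩
      · intro t'
        rw [hQ']
        by_cases h : t' = t
        · subst h
          rw [Function.update_self]
          exact Set.sdiff_subset.trans (hQ _)
        · rw [Function.update_of_ne h]
          exact hQ t'
      · intro t'
        by_cases h : t' = t
        · subst h
          rw [Function.update_self]
          rintro _ ⟨f, hf, -, rfl⟩
          exact (hH _ f hf).restrict _
        · rw [Function.update_of_ne h]
          exact hH t'
      · intro t'
        by_cases h : t' = t
        · subst h
          rw [Function.update_self]
          exact hloc _ a _ _ _ W hT hne' (hI _)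
        · rw [Function.update_of_ne h]
          exact hglob _ _ a _ _ _ _ h W hT hne' (hI t') (hI t)

/-! ### What remains of the futures of a totally dependent thread -/

/-- The action sequences of the complete runs of `c`. -/
def Com.traces (c : Com) : Set (List Action) := {l | ∃ p ∈ c.runs fun _ => 0, p.1 = l}

/-- In every run, each action depends on all the previous ones. -/
def Com.IsChain (dep : Label → Label → Prop) (c : Com) : Prop :=
  ∀ l ∈ c.traces, l.Pairwise fun a b => dep a.line b.line

section

variable {dep : Label → Label → Prop} {t : Tid} {c : Com} {L : List Label} {H : Set Future}
  {a : Action}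

/-- In a chain the only minimal unexecuted event is the next one in program order, so consumption
follows the run. Consuming removes events by their action; this loses nothing, because irreflexivity
of `dep` makes the actions of a chain distinct. -/
theorem exists_of_mem_foldl_candidates (hdep : ∀ i, ¬ dep i i) (hc : c.IsChain dep)
    {as : List Action} {f : Future}
    (hf : f ∈ as.foldl (fun G a => candidates a G) (threadFutures dep t c)) :
    ∃ l, as ++ l ∈ c.traces ∧ f = (runFuture dep t (as ++ l)).restrict {e | e.act ∉ as} := by
  induction as using List.reverseRecOn generalizing f with
  | nil =>
    obtain ⟨p, hp, rfl⟩ := hf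
    refine ⟨p.1, ⟨p, hp, rfl⟩, ?_⟩
    ext e
    · exact ⟨fun h => ⟨h, List.not_mem_nil⟩, fun h => h.1⟩
    · exact ⟨fun h => ⟨h, ⟨h.1, List.not_mem_nil⟩, ⟨h.2.1, List.not_mem_nil⟩⟩, fun h => h.1⟩
  | append_singleton as a ih =>
    rw [List.foldl_append] at hf
    obtain ⟨f, hf, ⟨e, he, rfl, hmin⟩, rfl⟩ := hf
    obtain ⟨l, hl, rfl⟩ := ih hf
    have hel : e.act ∈ l :=
      (List.mem_append.1 (mem_of_mem_runFuture he.1)).resolve_left he.2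
    cases l with
    | nil => cases hel
    | cons b l =>
      have hpw := hc _ hl
      rw [List.pairwise_append] at hpw
      have hb : b ∉ as := fun h => hdep _ (hpw.2.2 b h b List.mem_cons_self)
      have heb : e.act = b := by
        -- If the available action came later than `b`, the event of `b` would precede it, against
        -- minimality.
        refine (List.mem_cons.1 hel).resolve_right fun h => ?_
        have hbm : (⟨t, as, b⟩ : Evt) ∈ (runFuture dep t (as ++ b :: l)).carrier :=
          ⟨rfl, l, by simp⟩
        exact hmin ⟨t, as, b⟩ ⟨hbm, hb⟩
          ⟨⟨hbm, he.1, (List.pairwise_cons.1 hpw.2.1).1 _ h⟩, ⟨hbm, hb⟩, he⟩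
      subst heb
      refine ⟨l, by simpa using hl, ?_⟩
      have e₁ : as ++ [e.act] ++ l = as ++ e.act :: l := by simp
      rw [e₁]
      ext e'
      · constructor
        · rintro ⟨⟨h₁, h₂⟩, h₃⟩
          exact ⟨h₁, by simpa using ⟨h₂, h₃⟩⟩
        · rintro ⟨h₁, h₂⟩
          have : e'.act ∉ as ∧ e'.act ≠ e.act := by simpa using h₂
          exact ⟨⟨h₁, this.1⟩, this.2⟩
      · constructor
        · rintro ⟨⟨h, -⟩, ⟨⟨h₁, h₂⟩, h₃⟩, ⟨⟨h₄, h₅⟩, h₆⟩⟩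
          exact ⟨h, ⟨h₁, by simpa using ⟨h₂, h₃⟩⟩, ⟨h₄, by simpa using ⟨h₅, h₆⟩⟩⟩
        · rintro ⟨h, ⟨h₁, h₂⟩, ⟨h₃, h₄⟩⟩
          rename_i e''
          have h₅ : e'.act ∉ as ∧ e'.act ≠ e.act := by simpa using h₂
          have h₆ : e''.act ∉ as ∧ e''.act ≠ e.act := by simpa using h₄
          exact ⟨⟨h, ⟨h₁, h₅.1⟩, ⟨h₃, h₆.1⟩⟩, ⟨⟨h₁, h₅.1⟩, h₅.2⟩, ⟨⟨h₃, h₆.1⟩, h₆.2⟩⟩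

/-- Only the next action of a run can be executed. -/
theorem Remains.step (hdep : ∀ i, ¬ dep i i) (hc : c.IsChain dep)
    (h : Remains (threadFutures dep t c) L H) (hne : (candidates a H).Nonempty) :
    ∃ as l, as.map Action.line = L ∧ as ++ a :: l ∈ c.traces ∧
      Remains (threadFutures dep t c) (L ++ [a.line]) (candidates a H) ∧
      candidates a H = (as ++ [a]).foldl (fun G a => candidates a G) (threadFutures dep t c) := by
  obtain ⟨as, hL, rfl, -⟩ := h
  have e : candidates a (as.foldl (fun G a => candidates a G) (threadFutures dep t c)) =
      (as ++ [a]).foldl (fun G a => candidates a G) (threadFutures dep t c) := by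
    simp
  obtain ⟨f, hf⟩ := id hne
  rw [e] at hf
  obtain ⟨l, hl, -⟩ := exists_of_mem_foldl_candidates hdep hc hf
  exact ⟨as, l, hL, by simpa using hl, ⟨as ++ [a], by simp [hL], e, hne⟩, e⟩

theorem exists_of_mem_lines_foldl (hdep : ∀ i, ¬ dep i i) (hc : c.IsChain dep)
    {as : List Action} {i : Label}
    (h : i ∈ lines (as.foldl (fun G a => candidates a G) (threadFutures dep t c))) :
    ∃ l, as ++ l ∈ c.traces ∧ ∃ b ∈ l, b.line = i := by
  obtain ⟨f, hf, e, he, rfl⟩ := h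
  obtain ⟨l, hl, rfl⟩ := exists_of_mem_foldl_candidates hdep hc hf
  exact ⟨l, hl, e.act, (List.mem_append.1 (mem_of_mem_runFuture he.1)).resolve_left he.2, rfl⟩

/-- Makes a step at the guarded store contradict the `false` inside the branch, which the annotation
states as absence of that line. -/
theorem line_mem_lines_of_candidates (hne : (candidates a H).Nonempty) : a.line ∈ lines H := by
  obtain ⟨_, f, hf, ⟨e, he, rfl, -⟩, -⟩ := hne
  exact ⟨f, hf, e, he, rfl⟩

/-- Excludes termination at the initial annotation: neither test thread has an empty run. -/
theorem nil_mem_traces_of_finished (h : Remains (threadFutures dep t c) [] H)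
    (hfin : Finished H) : [] ∈ c.traces := by
  obtain ⟨as, hL, rfl, -⟩ := h
  obtain rfl : as = [] := by simpa using hL
  obtain ⟨p, hp, h⟩ := hfin
  refine ⟨p, hp, ?_⟩
  cases hp' : p.1 with
  | nil => rfl
  | cons b l =>
    have : (⟨t, [], b⟩ : Evt) ∈ Future.empty.carrier := by
      rw [h, hp']
      exact ⟨rfl, l, rfl⟩
    exact this.elim

theorem Remains.nil : Remains (threadFutures dep t c) [] (threadFutures dep t c) := by
  refine ⟨[], rfl, rfl, ?_⟩
  obtain ⟨p, hp⟩ := Com.runs_nonempty c fun _ => 0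
  exact ⟨_, p, hp, rfl⟩

end

/-! ### The simple test -/

theorem simpleProg_labelsDisjoint : simpleProg.LabelsDisjoint := by
  intro t t' s hs s' hs' e
  unfold Prog.atoms simpleProg at hs hs'
  split_ifs at hs with h₁ h₂ <;> split_ifs at hs' with h₃ h₄ <;>
    simp [Com.atoms] at hs hs' <;>
    first
    | exact h₁.trans h₃.symm
    | exact h₂.trans h₄.symm
    | (rcases hs with rfl | rfl <;> rcases hs' with rfl | rfl <;> simp [ACom.label] at e)

theorem simpleDep_irrefl (i : Label) : ¬ simpleDep i i := by
  rintro (⟨rfl, h⟩ | ⟨rfl, h⟩) <;> cases h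

theorem simple_traces_one {l : List Action} (h : l ∈ (simpleProg 1).traces) :
    ∃ v, l = [.rd 1 false .x v, .wr 2 false .z (v + 1)] := by
  obtain ⟨p, hp, rfl⟩ := h
  obtain ⟨_, ⟨v, rfl⟩, _, rfl, rfl⟩ := hp
  exact ⟨v, rfl⟩

/-- The runs of a load of `z` followed by a store to `x` that is guarded by the value read. -/
theorem ctrl_traces {i j : Label} {r : Reg} {l : List Action}
    (h : l ∈ (Com.seq (.atom (.load i false r .z))
      (.ite (fun ρ => decide (ρ r = 2)) (.atom (.store j false .x fun _ => 1)) .done)).traces) :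
    ∃ v, l = .rd i false .z v :: if v = 2 then [.wr j false .x 1] else [] := by
  obtain ⟨p, hp, rfl⟩ := h
  obtain ⟨_, ⟨v, rfl⟩, q, hq, rfl⟩ := hp
  refine ⟨v, ?_⟩
  by_cases hv : v = 2
  · simp [Com.runs, hv] at hq
    simp [hq, hv]
  · simp [Com.runs, hv] at hq
    simp [hq, hv]

theorem simple_traces_two {l : List Action} (h : l ∈ (simpleProg 2).traces) :
    ∃ v, l = .rd 3 false .z v :: if v = 2 then [.wr 4 false .x 1] else [] :=
  ctrl_traces h

theorem simple_chain_one : (simpleProg 1).IsChain simpleDep := by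
  intro l hl
  obtain ⟨v, rfl⟩ := simple_traces_one hl
  simp [simpleDep, Action.line]

theorem simple_chain_two : (simpleProg 2).IsChain simpleDep := by
  intro l hl
  obtain ⟨v, rfl⟩ := simple_traces_two hl
  split_ifs <;> simp [simpleDep, Action.line]

theorem simpleInv_one : simpleInv 1 = simpleInv₁ (threadFutures simpleDep 1 (simpleProg 1)) := by
  rw [← onThread_initFutures]
  rfl

theorem simpleInv_two : simpleInv 2 = simpleInv₂ (threadFutures simpleDep 2 (simpleProg 2)) := by
  rw [← onThread_initFutures]
  rfl

theorem simpleInv_idle {t : Tid} (h₁ : t ≠ 1) (h₂ : t ≠ 2) (H : Set Future) (C : Config) :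
    simpleInv t H C := by
  simp [simpleInv, h₁, h₂]

variable {a : Action} {C C' : Config} {t : Tid}

theorem simple_step_one (h : ThreadStep simpleProg 1 a C C') :
    (∃ v, a = .rd 1 false .x v ∧
      C'.γ = Function.update C.γ 1 (Function.update (C.γ 1) .r1 v)) ∨
    (a = .wr 2 false .z (C.γ 1 .r1 + 1) ∧ C'.γ = C.γ) := by
  obtain ⟨⟨s, hs, hA⟩, -⟩ := h
  generalize C'.γ = γ' at *
  rcases hs with hs | hs <;> obtain rfl : s = _ := hs <;> cases hA
  · exact .inl ⟨_, rfl, rfl⟩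
  · exact .inr ⟨rfl, rfl⟩

theorem simple_step_two (h : ThreadStep simpleProg 2 a C C') :
    (∃ v, a = .rd 3 false .z v ∧
      C'.γ = Function.update C.γ 2 (Function.update (C.γ 2) .r2 v)) ∨
    (a = .wr 4 false .x 1 ∧ C'.γ = C.γ) := by
  obtain ⟨⟨s, hs, hA⟩, -⟩ := h
  generalize C'.γ = γ' at *
  rcases hs with hs | hs | hs
  · obtain rfl : s = _ := hs
    cases hA
    exact .inl ⟨_, rfl, rfl⟩
  · obtain rfl : s = _ := hs
    cases hA
    exact .inr ⟨rfl, rfl⟩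
  · exact hs.elim

theorem simple_threadStep_tid (h : ThreadStep simpleProg t a C C') : t = 1 ∨ t = 2 := by
  obtain ⟨⟨s, hs, -⟩, -⟩ := h
  by_contra hne
  push Not at hne
  simp [Prog.atoms, simpleProg, hne.1, hne.2, Com.atoms] at hs

/-- Thread 1 is locally correct, and each of its steps respects the assertions of thread 2. -/
theorem simple_one_correct {G : Set Future} (W : C.σ.WF) (hT : ThreadStep simpleProg 1 a C C')
    (hne : (candidates a G).Nonempty) (hI : simpleInv 1 G C) :
    simpleInv 1 (candidates a G) C' ∧ ∀ F, simpleInv 2 F C → simpleInv 2 F C' := by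
  rw [simpleInv_one] at *
  rw [simpleInv_two]
  have hM := hT.2
  have hstep := simple_step_one hT
  rcases hI with ⟨hR, hz, hr2, hx⟩ | ⟨hR, hz, hr1, hr2⟩ | ⟨hR, -⟩ <;>
    obtain ⟨as, l, hL, hl, hR', -⟩ := hR.step simpleDep_irrefl simple_chain_one hne <;>
    obtain ⟨v, hl⟩ := simple_traces_one hl
  · obtain rfl : as = [] := by simpa using hL
    rcases hstep with ⟨p, rfl, hγ⟩ | ⟨rfl, -⟩
    · have hp : p = 0 := by
        by_contra h
        exact NotObs.read_ne hM (hx p h) rfl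
      subst hp
      refine ⟨.inr (.inl ⟨hR', hz.of_memEffect W hM (by simp), by simp [hγ], by simp [hγ, hr2]⟩),
        ?_⟩
      rintro F (⟨h₁, h₂⟩ | ⟨h₁, h₂, h₃⟩ | h)
      · exact .inl ⟨h₁, fun i hi => (h₂ i hi).of_memEffect hM (by simp)⟩
      · exact .inr (.inl ⟨h₁, by simpa [hγ] using h₂, h₃⟩)
      · exact .inr (.inr h)
    · simp at hl
  · obtain ⟨b, rfl⟩ : ∃ b, as = [b] :=
      List.length_eq_one_iff.1 (by simpa using congrArg List.length hL)
    rcases hstep with ⟨p, rfl, hγ⟩ | ⟨rfl, hγ⟩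
    · simp at hl
    · refine ⟨.inr (.inr ⟨hR', .inl (by simp [hγ, hr1])⟩), ?_⟩
      rintro F (⟨h₁, h₂⟩ | ⟨h₁, h₂, h₃⟩ | h)
      · refine .inl ⟨h₁, fun i hi => (h₂ i hi).of_memEffect hM ?_⟩
        -- The value written to `z` is `0 + 1`, one of the two that thread 2 may observe.
        rw [hr1]
        simpa using fun h => hi.2 h.symm
      · exact .inr (.inl ⟨h₁, by simpa [hγ] using h₂, h₃⟩)
      · exact .inr (.inr h)
  -- Both lines are already executed, and no run has a third action.
  · have h₁ := congrArg List.length hL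
    have h₂ := congrArg List.length hl
    simp at h₁ h₂
    omega

/-- Thread 2 is locally correct, and each of its steps respects the assertions of thread 1. -/
theorem simple_two_correct {G : Set Future} (W : C.σ.WF) (hT : ThreadStep simpleProg 2 a C C')
    (hne : (candidates a G).Nonempty) (hI : simpleInv 2 G C) :
    simpleInv 2 (candidates a G) C' ∧ ∀ F, simpleInv 1 F C → simpleInv 1 F C' := by
  rw [simpleInv_two] at *
  rw [simpleInv_one]
  have hM := hT.2
  have hstep := simple_step_two hT
  rcases hI with ⟨hR, hz⟩ | ⟨hR, hr2, h4⟩ | ⟨hR, -⟩ <;>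
    obtain ⟨as, l, hL, hl, hR', hfold⟩ := hR.step simpleDep_irrefl simple_chain_two hne <;>
    obtain ⟨v, hl⟩ := simple_traces_two hl
  · obtain rfl : as = [] := by simpa using hL
    rcases hstep with ⟨p, rfl, hγ⟩ | ⟨rfl, -⟩
    · have hp : p = 0 ∨ p = 1 := by
        by_contra h
        push Not at h
        exact NotObs.read_ne hM (hz p h) rfl
      have hp2 : p ≠ 2 := by rcases hp with rfl | rfl <;> norm_num
      refine ⟨.inr (.inl ⟨hR', by simpa [hγ] using hp, fun h => ?_⟩), ?_⟩
      -- A run that begins by reading `p ≠ 2` skips the branch, so nothing is left of it.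
      · rw [hfold] at h
        obtain ⟨l', hl', b, hb, -⟩ :=
          exists_of_mem_lines_foldl simpleDep_irrefl simple_chain_two h
        obtain ⟨q, hq⟩ := simple_traces_two hl'
        simp only [List.nil_append, List.cons_append, List.cons.injEq, Action.rd.injEq,
          true_and] at hq
        obtain ⟨rfl, rfl⟩ := hq
        simp [hp2] at hb
      -- `[z = 0]_2` forces the load to return `0`, which preserves `r2 = 0` in the first two
      -- annotations of thread 1; the last one only needs a value other than `2`.
      · rintro F (⟨h₁, h₂, h₃, h₄⟩ | ⟨h₁, h₂, h₃, h₄⟩ | ⟨h₁, -⟩)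
        · have := h₂.read_eq hM
          subst this
          exact .inl ⟨h₁, h₂.of_memEffect W hM (by simp), by simp [hγ],
            fun i hi => (h₄ i hi).of_memEffect hM (by simp)⟩
        · have := h₂.read_eq hM
          subst this
          exact .inr (.inl ⟨h₁, h₂.of_memEffect W hM (by simp), by simp [hγ, h₃], by simp [hγ]⟩)
        · exact .inr (.inr ⟨h₁, .inr (by simpa [hγ] using hp2)⟩)
    · simp at hl
  · obtain ⟨b, rfl⟩ : ∃ b, as = [b] :=
      List.length_eq_one_iff.1 (by simpa using congrArg List.length hL)
    -- The only possible second action is the guarded store, whose line the annotation excludes.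
    have := line_mem_lines_of_candidates hne
    split_ifs at hl <;> simp at hl
    obtain ⟨-, rfl, -⟩ := hl
    exact (h4 this).elim
  · have h₁ := congrArg List.length hL
    have h₂ := congrArg List.length hl
    split_ifs at h₂ <;> simp at h₁ h₂ <;> omega

theorem simple_correct :
    ValidOutline simpleDep simpleInit simplePre simpleProg simpleInv simplePost ∧
      HoareTriple simpleDep simpleInit simplePre simpleProg simplePost := by
  refine validOutline_and_hoareTriple simpleProg_labelsDisjoint ?_ ?_ ?_ ?_ ?_
  · rintro C ⟨hσ, -, hr2⟩
    exact ⟨⟨defObs_initGraph hσ (by simp), hr2, fun i hi => notObs_initGraph hσ hi⟩,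
      fun i hi => notObs_initGraph hσ hi.1⟩
  · rintro C ⟨h₁, h₂⟩ t
    by_cases ht₁ : t = 1
    · subst ht₁
      rw [simpleInv_one]
      exact .inl ⟨.nil, h₁⟩
    by_cases ht₂ : t = 2
    · subst ht₂
      rw [simpleInv_two]
      exact .inl ⟨.nil, h₂⟩
    exact simpleInv_idle ht₁ ht₂ _ _
  · intro C h
    obtain ⟨H, hfin, hI⟩ := h 1
    rw [simpleInv_one] at hI
    rcases hI with ⟨hR, -⟩ | ⟨-, -, hr1, -⟩ | ⟨-, h⟩
    · obtain ⟨v, hv⟩ := simple_traces_one (nil_mem_traces_of_finished hR hfin)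
      simp at hv
    · exact .inl (by simp [hr1])
    · exact h
  · intro t a C C' G W hT hne hI
    rcases simple_threadStep_tid hT with rfl | rfl
    · exact (simple_one_correct W hT hne hI).1
    · exact (simple_two_correct W hT hne hI).1
  · intro t₁ t₂ a C C' F G ht W hT hne hF hI
    by_cases ht₁ : t₁ = 1 ∨ t₁ = 2
    · rcases simple_threadStep_tid hT with rfl | rfl
      · obtain rfl := ht₁.resolve_left ht
        exact (simple_one_correct W hT hne hI).2 F hF
      · obtain rfl := ht₁.resolve_right ht
        exact (simple_two_correct W hT hne hI).2 F hF
    · push Not at ht₁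
      exact simpleInv_idle ht₁.1 ht₁.2 _ _

/-! ### The full test -/

theorem fullProg_labelsDisjoint : fullProg.LabelsDisjoint := by
  intro t t' s hs s' hs' e
  unfold Prog.atoms fullProg at hs hs'
  split_ifs at hs with h₁ h₂ <;> split_ifs at hs' with h₃ h₄ <;>
    simp [Com.atoms] at hs hs' <;>
    first
    | exact h₁.trans h₃.symm
    | exact h₂.trans h₄.symm
    | (rcases hs with rfl | rfl | rfl | rfl | rfl <;> rcases hs' with rfl | rfl <;>
        simp [ACom.label] at e)
    | (rcases hs with rfl | rfl <;> rcases hs' with rfl | rfl | rfl | rfl | rfl <;>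
        simp [ACom.label] at e)

theorem fullDep_irrefl (i : Label) : ¬ fullDep i i := by
  rintro (⟨-, h, -⟩ | ⟨rfl, h⟩)
  · exact lt_irrefl _ h
  · cases h

theorem full_traces_one {l : List Action} (h : l ∈ (fullProg 1).traces) :
    ∃ v u, l = [.rd 1 false .x v, .loc 2, .wr 3 false .y v, .rd 4 false .y u,
      .wr 5 false .z (u + 1)] := by
  obtain ⟨p, hp, rfl⟩ := h
  obtain ⟨_, ⟨v, rfl⟩, _, ⟨_, rfl, _, ⟨_, rfl, _, ⟨_, ⟨u, rfl⟩, _, rfl, rfl⟩, rfl⟩, rfl⟩, rfl⟩ := hp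
  exact ⟨v, u, rfl⟩

theorem full_traces_two {l : List Action} (h : l ∈ (fullProg 2).traces) :
    ∃ v, l = .rd 6 false .z v :: if v = 2 then [.wr 7 false .x 1] else [] :=
  ctrl_traces h

theorem full_chain_one : (fullProg 1).IsChain fullDep := by
  intro l hl
  obtain ⟨v, u, rfl⟩ := full_traces_one hl
  simp [fullDep, Action.line]

theorem full_chain_two : (fullProg 2).IsChain fullDep := by
  intro l hl
  obtain ⟨v, rfl⟩ := full_traces_two hl
  split_ifs <;> simp [fullDep, Action.line]

theorem fullInv_one : fullInv 1 = fullInv₁ (threadFutures fullDep 1 (fullProg 1)) := by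
  rw [← onThread_initFutures]
  rfl

theorem fullInv_two : fullInv 2 = fullInv₂ (threadFutures fullDep 2 (fullProg 2)) := by
  rw [← onThread_initFutures]
  rfl

theorem fullInv_idle {t : Tid} (h₁ : t ≠ 1) (h₂ : t ≠ 2) (H : Set Future) (C : Config) :
    fullInv t H C := by
  simp [fullInv, h₁, h₂]

theorem full_step_one (h : ThreadStep fullProg 1 a C C') :
    (∃ v, a = .rd 1 false .x v ∧
      C'.γ = Function.update C.γ 1 (Function.update (C.γ 1) .r1 v)) ∨
    (a = .loc 2 ∧ C'.γ = Function.update C.γ 1 (Function.update (C.γ 1) .r2 (C.γ 1 .r1))) ∨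
    (a = .wr 3 false .y (C.γ 1 .r2) ∧ C'.γ = C.γ) ∨
    (∃ v, a = .rd 4 false .y v ∧
      C'.γ = Function.update C.γ 1 (Function.update (C.γ 1) .r3 v)) ∨
    (a = .wr 5 false .z (C.γ 1 .r3 + 1) ∧ C'.γ = C.γ) := by
  obtain ⟨⟨s, hs, hA⟩, -⟩ := h
  generalize C'.γ = γ' at *
  rcases hs with hs | hs | hs | hs | hs <;> obtain rfl : s = _ := hs <;> cases hA
  · exact .inl ⟨_, rfl, rfl⟩
  · exact .inr (.inl ⟨rfl, rfl⟩)
  · exact .inr (.inr (.inl ⟨rfl, rfl⟩))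
  · exact .inr (.inr (.inr (.inl ⟨_, rfl, rfl⟩)))
  · exact .inr (.inr (.inr (.inr ⟨rfl, rfl⟩)))

theorem full_step_two (h : ThreadStep fullProg 2 a C C') :
    (∃ v, a = .rd 6 false .z v ∧
      C'.γ = Function.update C.γ 2 (Function.update (C.γ 2) .r4 v)) ∨
    (a = .wr 7 false .x 1 ∧ C'.γ = C.γ) := by
  obtain ⟨⟨s, hs, hA⟩, -⟩ := h
  generalize C'.γ = γ' at *
  rcases hs with hs | hs | hs
  · obtain rfl : s = _ := hs
    cases hA
    exact .inl ⟨_, rfl, rfl⟩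
  · obtain rfl : s = _ := hs
    cases hA
    exact .inr ⟨rfl, rfl⟩
  · exact hs.elim

theorem full_threadStep_tid (h : ThreadStep fullProg t a C C') : t = 1 ∨ t = 2 := by
  obtain ⟨⟨s, hs, -⟩, -⟩ := h
  by_contra hne
  push Not at hne
  simp [Prog.atoms, fullProg, hne.1, hne.2, Com.atoms] at hs

/-- Actions of other threads that do not write a value outside `{0, 1}` to `z` respect the
assertions of thread 2. -/
theorem fullInv_two_stable {G F : Set Future} (hM : MemEffect t a C C') (hγ : C'.γ 2 = C.γ 2)
    (ha : ∀ i r v, a = .wr i r .z v → v = 1) (hI : fullInv₂ G F C) : fullInv₂ G F C' := by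
  rcases hI with ⟨h₁, h₂⟩ | ⟨h₁, h₂, h₃⟩ | ⟨h₁, h₂⟩
  · exact .inl ⟨h₁, fun i hi => (h₂ i hi).of_memEffect hM fun j r e => hi.2 (ha j r i e)⟩
  · exact .inr (.inl ⟨h₁, by rwa [hγ], h₃⟩)
  · exact .inr (.inr ⟨h₁, by rwa [hγ]⟩)

/-- Thread 1 is locally correct, and each of its steps respects the assertions of thread 2. -/
theorem full_one_correct {G : Set Future} (W : C.σ.WF) (hT : ThreadStep fullProg 1 a C C')
    (hne : (candidates a G).Nonempty) (hI : fullInv 1 G C) :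
    fullInv 1 (candidates a G) C' ∧ ∀ F, fullInv 2 F C → fullInv 2 F C' := by
  rw [fullInv_one] at *
  rw [fullInv_two]
  have hM := hT.2
  have hstep := full_step_one hT
  -- All runs of thread 1 have the same lines, so the number of executed lines determines the next
  -- one.
  have hnext : ∀ L, Remains (threadFutures fullDep 1 (fullProg 1)) L G →
      [1, 2, 3, 4, 5][L.length]? = some a.line ∧
      Remains (threadFutures fullDep 1 (fullProg 1)) (L ++ [a.line]) (candidates a G) := by
    intro L hR
    obtain ⟨as, l, rfl, hl, hR', -⟩ := hR.step fullDep_irrefl full_chain_one hne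
    obtain ⟨v, u, hl⟩ := full_traces_one hl
    refine ⟨?_, hR'⟩
    have := congrArg (fun l => (l.map Action.line)[as.length]?) hl
    simpa [Action.line] using this.symm
  -- Six annotations against five commands: `hline` leaves just the five pairs in program order. The
  -- only write to `z` is `r3 + 1` with `r3 = 0`, as `fullInv_two_stable` requires.
  rcases hI with ⟨hR, hy, hz, hx⟩ | ⟨hR, hy, hz, hr⟩ | ⟨hR, hy, hz, hr⟩ | ⟨hR, hy, hz⟩ |
      ⟨hR, hz, hr⟩ | ⟨hR, hr⟩ <;>
    obtain ⟨hline, hR'⟩ := hnext _ hR <;>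
    rcases hstep with ⟨p, rfl, hγ⟩ | ⟨rfl, hγ⟩ | ⟨rfl, hγ⟩ | ⟨p, rfl, hγ⟩ | ⟨rfl, hγ⟩ <;>
    first
    | (exfalso; simp [Action.line] at hline; done)
    | refine ⟨?_, fun F => fullInv_two_stable hM (by simp [hγ]) (by simp [*])⟩
  · have hp : p = 0 := by
      by_contra h
      exact NotObs.read_ne hM (hx p h) rfl
    subst hp
    exact .inr (.inl ⟨hR', hy.of_memEffect W hM (by simp), hz.of_memEffect W hM (by simp),
      by simp [hγ]⟩)
  · exact .inr (.inr (.inl ⟨hR', hy.of_memEffect W hM (by simp), hz.of_memEffect W hM (by simp),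
      by simp [hγ, hr]⟩))
  -- Since `r2 = 0`, the thread overwrites `y` with `0` and goes on observing `0` there.
  · rw [hr] at hM
    exact .inr (.inr (.inr (.inl ⟨hR', hy.of_write W hM, hz.of_memEffect W hM (by simp)⟩)))
  · obtain rfl := hy.read_eq hM
    exact .inr (.inr (.inr (.inr (.inl ⟨hR', hz.of_memEffect W hM (by simp), by simp [hγ]⟩))))
  · exact .inr (.inr (.inr (.inr (.inr ⟨hR', by simp [hγ, hr]⟩))))

/-- Thread 2 is locally correct, and each of its steps respects the assertions of thread 1. -/
theorem full_two_correct {G : Set Future} (W : C.σ.WF) (hT : ThreadStep fullProg 2 a C C')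
    (hne : (candidates a G).Nonempty) (hI : fullInv 2 G C) :
    fullInv 2 (candidates a G) C' ∧ ∀ F, fullInv 1 F C → fullInv 1 F C' := by
  rw [fullInv_two] at *
  rw [fullInv_one]
  have hM := hT.2
  have hstep := full_step_two hT
  rcases hI with ⟨hR, hz⟩ | ⟨hR, hr4, h7⟩ | ⟨hR, -⟩ <;>
    obtain ⟨as, l, hL, hl, hR', hfold⟩ := hR.step fullDep_irrefl full_chain_two hne <;>
    obtain ⟨v, hl⟩ := full_traces_two hl
  · obtain rfl : as = [] := by simpa using hL
    rcases hstep with ⟨p, rfl, hγ⟩ | ⟨rfl, -⟩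
    · have hp : p = 0 ∨ p = 1 := by
        by_contra h
        push Not at h
        exact NotObs.read_ne hM (hz p h) rfl
      have hp2 : p ≠ 2 := by rcases hp with rfl | rfl <;> norm_num
      have hγ1 : C'.γ 1 = C.γ 1 := by simp [hγ]
      refine ⟨.inr (.inl ⟨hR', by simpa [hγ] using hp, fun h => ?_⟩), ?_⟩
      · rw [hfold] at h
        obtain ⟨l', hl', b, hb, -⟩ :=
          exists_of_mem_lines_foldl fullDep_irrefl full_chain_two h
        obtain ⟨q, hq⟩ := full_traces_two hl'
        simp only [List.nil_append, List.cons_append, List.cons.injEq, Action.rd.injEq,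
          true_and] at hq
        obtain ⟨rfl, rfl⟩ := hq
        simp [hp2] at hb
      · have hD : ∀ y v u, DefObs y v u C → DefObs y v u C' :=
          fun y v u h => h.of_memEffect W hM (by simp)
        unfold fullInv₁ fullPre₁
        rw [hγ1]
        rintro F (⟨h₁, h₂, h₃, h₄⟩ | ⟨h₁, h₂, h₃, h₄⟩ | ⟨h₁, h₂, h₃, h₄⟩ | ⟨h₁, h₂, h₃⟩ |
          ⟨h₁, h₂, h₃⟩ | h)
        · exact .inl ⟨h₁, hD _ _ _ h₂, hD _ _ _ h₃,
            fun i hi => (h₄ i hi).of_memEffect hM (by simp)⟩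
        · exact .inr (.inl ⟨h₁, hD _ _ _ h₂, hD _ _ _ h₃, h₄⟩)
        · exact .inr (.inr (.inl ⟨h₁, hD _ _ _ h₂, hD _ _ _ h₃, h₄⟩))
        · exact .inr (.inr (.inr (.inl ⟨h₁, hD _ _ _ h₂, hD _ _ _ h₃⟩)))
        · exact .inr (.inr (.inr (.inr (.inl ⟨h₁, hD _ _ _ h₂, h₃⟩))))
        · exact .inr (.inr (.inr (.inr (.inr h))))
    · simp at hl
  · obtain ⟨b, rfl⟩ : ∃ b, as = [b] :=
      List.length_eq_one_iff.1 (by simpa using congrArg List.length hL)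
    have := line_mem_lines_of_candidates hne
    split_ifs at hl <;> simp at hl
    obtain ⟨-, rfl, -⟩ := hl
    exact (h7 this).elim
  · have h₁ := congrArg List.length hL
    have h₂ := congrArg List.length hl
    split_ifs at h₂ <;> simp at h₁ h₂ <;> omega

theorem full_correct :
    ValidOutline fullDep fullInit fullPre fullProg fullInv fullPost ∧
      HoareTriple fullDep fullInit fullPre fullProg fullPost := by
  refine validOutline_and_hoareTriple fullProg_labelsDisjoint ?_ ?_ ?_ ?_ ?_
  · rintro C ⟨hσ, -⟩
    exact ⟨⟨defObs_initGraph hσ (by simp), defObs_initGraph hσ (by simp),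
      fun i hi => notObs_initGraph hσ hi⟩, fun i hi => notObs_initGraph hσ hi.1⟩
  · rintro C ⟨h₁, h₂⟩ t
    by_cases ht₁ : t = 1
    · subst ht₁
      rw [fullInv_one]
      exact .inl ⟨.nil, h₁⟩
    by_cases ht₂ : t = 2
    · subst ht₂
      rw [fullInv_two]
      exact .inl ⟨.nil, h₂⟩
    exact fullInv_idle ht₁ ht₂ _ _
  · intro C h
    -- Thread 2 decides the postcondition: all its annotations but the first bound `r4`, while the
    -- early ones of thread 1 say nothing about `r3`.
    obtain ⟨H, hfin, hI⟩ := h 2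
    rw [fullInv_two] at hI
    rcases hI with ⟨hR, -⟩ | ⟨-, hr, -⟩ | ⟨-, hr⟩
    · obtain ⟨v, hv⟩ := full_traces_two (nil_mem_traces_of_finished hR hfin)
      simp at hv
    all_goals exact .inr (by rcases hr with hr | hr <;> simp [hr])
  · intro t a C C' G W hT hne hI
    rcases full_threadStep_tid hT with rfl | rfl
    · exact (full_one_correct W hT hne hI).1
    · exact (full_two_correct W hT hne hI).1
  · intro t₁ t₂ a C C' F G ht W hT hne hF hI
    by_cases ht₁ : t₁ = 1 ∨ t₁ = 2
    · rcases full_threadStep_tid hT with rfl | rfl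
      · obtain rfl := ht₁.resolve_left ht
        exact (full_one_correct W hT hne hI).2 F hF
      · obtain rfl := ht₁.resolve_right ht
        exact (full_two_correct W hT hne hI).2 F hF
    · push Not at ht₁
      exact fullInv_idle ht₁.1 ht₁.2 _ _

end MRD

theorem mainTheorem5 :
    (MRD.ValidOutline MRD.simpleDep MRD.simpleInit MRD.simplePre MRD.simpleProg
        MRD.simpleInv MRD.simplePost ∧
      MRD.HoareTriple MRD.simpleDep MRD.simpleInit MRD.simplePre MRD.simpleProg
        MRD.simplePost) ∧
    (MRD.ValidOutline MRD.fullDep MRD.fullInit MRD.fullPre MRD.fullProg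
        MRD.fullInv MRD.fullPost ∧
      MRD.HoareTriple MRD.fullDep MRD.fullInit MRD.fullPre MRD.fullProg
        MRD.fullPost) := by
  exact ⟨MRD.simple_correct, MRD.full_correct⟩
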